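/- Let $n\ge 3$ and write $\mathbb S^n\subset\mathbb C\oplus\mathbb R^{n-1}$. Mean curvature means the trace of the second fundamental form (unnormalized). For $h>0$ let $s_h\in(0,\frac{\pi}{2})$ be the unique solution of $-\tan s_h+(n-2)\cot s_h=h$, and put $$C_h=\cos s_h\,\sin^{n-2}s_h-\frac{h}{n-1}\sin^{n-1}s_h .$$ For $C\in(0,C_h)$ let $J(C,h)=\{s\in(0,\frac{\pi}{2}) : C+\frac{h}{n-1}\sin^{n-1}s<\cos s\,\sin^{n-2}s\}$ (an open interval), let $$\dot s_1(s)=\frac{C+\frac{h}{n-1}\sin^{n-1}s}{\cos s\,\sqrt{\cos^2 s\,\sin^{2(n-2)}s-\bigl(C+\frac{h}{n-1}\sin^{n-1}s\bigr)^2}}\qquad(s\in J(C,h)),$$ and define the width $W(h,C)=2\int_{J(C,h)}\dot s_1\,ds$. Let $s_1(s)=\int_{J(C,h),\,t<s}\dot s_1(t)\,dt$. The unduloid type Delaunay hypersurface with parameters $h,C$ is the set $M_{h,C}\subset\mathbb S^n$ of all points $(c,\,b\,x)$, where $x\in\mathbb S^{n-2}\subset\mathbb R^{n-1}$ and $(c,b)$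 runs through the generating curve $$\gamma_{h,C}=\bigl\{\bigl(\cos s\; e^{i(\pm s_1(s)+mW(h,C))},\ \sin s\bigr) : s\in\overline{J(C,h)},\ m\in\mathbb Z\bigr\}\subset\mathbb S^2\subset\mathbb C\oplus\mathbb R ,$$ which is obtained from the local curve $(\cos s\;e^{is_1(s)},\sin s)$ by repeated reflection in the $s_1$-direction. **Theorem.** Let $n\ge3$. For every $h\in\Bigl(0,\sqrt{\tfrac{4(n-2)}{3}}\Bigr)$ there is some $C\in(0,C_h)$ for which $\dot s_1$ is integrable on $J(C,h)$, $W(h,C)=\pi$, and the generating curve and the hypersurface are embedded: there is a smooth embedding $\sigma=(c,b):S^1\to\mathbb C\oplus\mathbb R$ with image $\gamma_{h,C}$ such that $(t,x)\mapsto(c(t),b(t)x)$ is a smooth embedding of $S^1\times\mathbb S^{n-2}$ into $\mathbb S^n$ with image $M_{h,C}$ and with constant mean curvature $h$ with respect to the inner unit normal (the one whose $\mathbb R^{n-1}$-component has negative inner product with $x$). In particular, there are uncountably many $h>0$ for each of which there is an embedded $h$-CMC Delaunay hypersurface (of unduloid type) in $\mathbb S^n$. -/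

import Mathlib

open Set MeasureTheory
open scoped Manifold ContDiff InnerProductSpace

namespace Delaunay

noncomputable section

/-! ### The local curves

A curve `(cos s · e^{i s₁(s)}, sin s)` in `S² ⊆ ℂ ⊕ ℝ`, with `0 < s < π/2`, generates a hypersurface
of `Sⁿ` of (unnormalized) constant mean curvature `h` when `s₁' = phaseSpeed n h C s` for a constant
`C`. -/

/-- The function `L(s) = cos s · sin^{n-2} s`. -/
def L (n : ℕ) (s : ℝ) : ℝ := Real.cos s * Real.sin s ^ (n - 2)

/-- The function `R(s, C, h) = C + h/(n-1) · sin^{n-1} s`. -/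
def R (n : ℕ) (h C s : ℝ) : ℝ := C + h / ((n : ℝ) - 1) * Real.sin s ^ (n - 1)

/-- The angle `s_h ∈ (0, π/2)` with `-tan s_h + (n-2) cot s_h = h`, at which the graph of `L` touches
a graph `R(·, C, h)`; see `eq_contactAngle_iff`. -/
def contactAngle (n : ℕ) (h : ℝ) : ℝ :=
  Real.arctan (2 * ((n : ℝ) - 2) / (h + Real.sqrt (h ^ 2 + 4 * ((n : ℝ) - 2))))

/-- The constant `C_h` for which the graphs of `L` and `R(·, C_h, h)` touch at `s_h`. -/
def Cmax (n : ℕ) (h : ℝ) : ℝ := L n (contactAngle n h) - R n h 0 (contactAngle n h)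

/-- The set of all `s ∈ (0, π/2)` at which the expression for `s₁'` makes sense. When `h > 0` and
`0 < C < C_h` the absolute value is redundant and this is an open interval. -/
def J (n : ℕ) (h C : ℝ) : Set ℝ := {s | s ∈ Ioo 0 (Real.pi / 2) ∧ |R n h C s| < L n s}

/-- The derivative `s₁'(s)` of the phase of a local curve with parameters `h`, `C`. -/
def phaseSpeed (n : ℕ) (h C s : ℝ) : ℝ :=
  R n h C s / (Real.cos s * Real.sqrt (L n s ^ 2 - R n h C s ^ 2))

/-- The width `W(h, C)` of one period. -/
def W (n : ℕ) (h C : ℝ) : ℝ := 2 * ∫ s in J n h C, phaseSpeed n h C s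

/-- The phase `s₁(s)`, normalized to vanish at the left end of `J`. -/
def phase (n : ℕ) (h C s : ℝ) : ℝ := ∫ t in J n h C ∩ Iio s, phaseSpeed n h C t

/-! ### The global curves and hypersurfaces -/

/-- The ambient space `ℂ ⊕ ℝ^{n-1}` of `Sⁿ`, for `n ≥ 2` (so that `n - 2 + 1 = n - 1`). -/
abbrev Ambient (n : ℕ) : Type := WithLp 2 (ℂ × EuclideanSpace ℝ (Fin (n - 2 + 1)))

/-- The unit sphere `S^{n-2}` of `ℝ^{n-1}`. -/
abbrev Orbit (n : ℕ) : Type := Metric.sphere (0 : EuclideanSpace ℝ (Fin (n - 2 + 1))) 1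

/-- The global generating curve in `S² ⊆ ℂ ⊕ ℝ`, for `h > 0` and `0 < C < C_h`. Reflecting the local
curve over and over in the `s₁`-direction at its two ends, whose phases are `0` and `W(h, C) / 2`,
produces the copies of it in which the phase `s₁` is replaced by `± s₁ + m W(h, C)`, with `m ∈ ℤ`. -/
def generatingCurve (n : ℕ) (h C : ℝ) : Set (WithLp 2 (ℂ × ℝ)) :=
  {p | ∃ s ∈ closure (J n h C), ∃ (m : ℤ) (θ : ℝ),
    (θ = phase n h C s + m * W n h C ∨ θ = -phase n h C s + m * W n h C) ∧
    p = WithLp.toLp 2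
      ((Real.cos s : ℂ) * Complex.exp ((θ : ℂ) * Complex.I), Real.sin s)}

/-- The map `(t, x) ↦ (c(t), b(t) x)` generated by a curve `σ(t) = (c(t), b(t))` in `ℂ ⊕ ℝ`. -/
def spiralProduct (n : ℕ) {T : Type*} (σ : T → WithLp 2 (ℂ × ℝ)) (q : T × Orbit n) : Ambient n :=
  WithLp.toLp 2 ((σ q.1).fst, (σ q.1).snd • (q.2 : EuclideanSpace ℝ (Fin (n - 2 + 1))))

/-- The Delaunay hypersurface with parameters `h > 0` and `0 < C < C_h` (that is, of unduloid type),
obtained by rotating the global generating curve. -/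
def delaunayHypersurface (n : ℕ) (h C : ℝ) : Set (Ambient n) :=
  {P | ∃ p ∈ generatingCurve n h C, ∃ x : Orbit n,
    P = WithLp.toLp 2 (p.fst, p.snd • (x : EuclideanSpace ℝ (Fin (n - 2 + 1))))}

/-! ### Embeddings and mean curvature -/

section Geometry

variable {E H M F : Type*} [NormedAddCommGroup E] [NormedSpace ℝ E] [TopologicalSpace H]
  [TopologicalSpace M] [ChartedSpace H M] [NormedAddCommGroup F] [InnerProductSpace ℝ F]

/-- A smooth embedding of a manifold without boundary into a Euclidean space: a smooth immersion
that is a homeomorphism onto its image. -/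
structure IsEmbedded (I : ModelWithCorners ℝ E H) (Φ : M → F) : Prop where
  smooth : ContMDiff I 𝓘(ℝ, F) ∞ Φ
  immersion : ∀ p, Function.Injective (mvfderiv I Φ p)
  embedding : Topology.IsEmbedding Φ

/-- `ν` is a smooth unit normal field, tangent to the unit sphere of `F`, along the hypersurface
`Φ : M → F` of that unit sphere. -/
structure IsUnitNormal (I : ModelWithCorners ℝ E H) (Φ ν : M → F) : Prop where
  mem_sphere : ∀ p, ‖Φ p‖ = 1
  codim_one : Module.finrank ℝ F = Module.finrank ℝ E + 2
  smooth : ContMDiff I 𝓘(ℝ, F) ∞ ν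
  unit : ∀ p, ‖ν p‖ = 1
  tangent_sphere : ∀ p, ⟪ν p, Φ p⟫_ℝ = 0
  normal : ∀ p v, ⟪ν p, mvfderiv I Φ p v⟫_ℝ = 0

/-- The hypersurface `Φ` of the unit sphere has constant (unnormalized) mean curvature `h` with
respect to the unit normal field `ν`: at each point the shape operator `S`, which is given by
`dν = -dΦ ∘ S` (equivalently, the second fundamental form `⟪d²Φ, ν⟫` is `⟪dΦ (S ·), dΦ ·⟫`), has
trace `h`. As `dν` is orthogonal to `Φ`, its ambient value is the covariant derivative of `ν` in the
sphere. -/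
def HasCMC (I : ModelWithCorners ℝ E H) (Φ ν : M → F) (h : ℝ) : Prop :=
  ∀ p, ∃ S : TangentSpace I p →ₗ[ℝ] TangentSpace I p,
    (∀ v, mvfderiv I ν p v = -mvfderiv I Φ p (S v)) ∧ LinearMap.trace ℝ _ S = h

end Geometry

/-- The generating curve with parameters `h`, `C` closes up to an embedded closed curve `σ`, and the
Delaunay hypersurface is the image of the smooth embedding of `S¹ × S^{n-2}` into `Sⁿ` generated by
`σ`, which has constant mean curvature `h` with respect to the inner unit normal field `ν` (the one
pointing towards the core circle `S¹ × {0}` of the solid tube that the hypersurface bounds). -/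
def IsEmbeddedDelaunay (n : ℕ) (h C : ℝ) : Prop :=
  ∃ (σ : Circle → WithLp 2 (ℂ × ℝ)) (ν : Circle × Orbit n → Ambient n),
    IsEmbedded (𝓡 1) σ ∧
    range σ = generatingCurve n h C ∧
    IsEmbedded ((𝓡 1).prod (𝓡 (n - 2))) (spiralProduct n σ) ∧
    range (spiralProduct n σ) = delaunayHypersurface n h C ∧
    IsUnitNormal ((𝓡 1).prod (𝓡 (n - 2))) (spiralProduct n σ) ν ∧
    (∀ q, ⟪(ν q).snd, (q.2 : EuclideanSpace ℝ (Fin (n - 2 + 1)))⟫_ℝ < 0) ∧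
    HasCMC ((𝓡 1).prod (𝓡 (n - 2))) (spiralProduct n σ) ν h

/-- The defining property of `s_h`. -/
theorem eq_contactAngle_iff {n : ℕ} (hn : 3 ≤ n) (h : ℝ) {s : ℝ}
    (hs : s ∈ Ioo 0 (Real.pi / 2)) :
    -Real.tan s + ((n : ℝ) - 2) * Real.cot s = h ↔ s = contactAngle n h := by
  have hn' : (3 : ℝ) ≤ n := by exact_mod_cast hn
  obtain ⟨hs0, hs1⟩ := hs
  have ht : 0 < Real.tan s := Real.tan_pos_of_pos_of_lt_pi_div_two hs0 hs1
  set m : ℝ := (n : ℝ) - 2 with hm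
  have hm0 : 0 < m := by linarith
  set r : ℝ := Real.sqrt (h ^ 2 + 4 * m) with hr
  have hr2 : r ^ 2 = h ^ 2 + 4 * m := Real.sq_sqrt (by positivity)
  have hr0 : 0 ≤ r := Real.sqrt_nonneg _
  have hpos : 0 < h + r := by nlinarith
  have key : s = contactAngle n h ↔ Real.tan s = 2 * m / (h + r) := by
    constructor
    · intro e
      rw [e, contactAngle, Real.tan_arctan]
    · intro e
      rw [contactAngle, ← hm, ← hr, ← e, Real.arctan_tan (by linarith) hs1]
  rw [key, ← Real.tan_inv_eq_cot, eq_div_iff hpos.ne']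
  set t := Real.tan s
  constructor
  · intro e
    have e1 : t ^ 2 + h * t - m = 0 := by
      field_simp at e
      linarith
    have : (t * (h + r) - 2 * m) * (t * (h + r) + 2 * t ^ 2) = 0 := by
      have hm' : m = t ^ 2 + h * t := by linarith
      rw [hm'] at hr2
      have : (r - (h + 2 * t)) * (r + (h + 2 * t)) = 0 := by linarith
      rw [hm']
      have h3 : (t * (h + r) - 2 * (t ^ 2 + h * t)) * (t * (h + r) + 2 * t ^ 2)
        = t ^ 2 * ((r - (h + 2 * t)) * (r + (h + 2 * t))) := by ring
      rw [h3, this, mul_zero]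
    rcases mul_eq_zero.1 this with h1 | h1
    · linarith
    · nlinarith [mul_pos ht hpos]
  · intro e
    have e1 : t ^ 2 + h * t - m = 0 := by
      have h2 : (r + h) * (t ^ 2 + h * t - m) = 0 := by
        have : t ^ 2 * (h + r) = 2 * m * t := by rw [← e]; ring
        nlinarith
      rcases mul_eq_zero.1 h2 with h3 | h3
      · linarith
      · exact h3
    field_simp
    linarith

end

end Delaunay

namespace Delaunay

noncomputable section

/-! ### A Morse coordinate at a nondegenerate maximum -/

/-! Along the generating curve the phase is strictly increasing, and it grows by `W n h C` per
period. If `W = π`, two periods make exactly one turn, so the curve closes up without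
self-intersection; rotating it keeps it embedded because the latitude stays in `(0, π/2)`. What
remains is to find `C` with `W = π`, by the intermediate value theorem in `C`.

Near `Cmax`: `J` is a superlevel set of `gap = L - R(·, 0, h)`, which has a nondegenerate maximum at
the contact angle. In a Morse coordinate `gap` equals `Cmax - y²`, and `y = √(Cmax - C) sin φ`
removes the square-root singularities of `phaseSpeed` at the ends of `J`. Thus `W` becomes an
integral over a fixed interval, with integrand continuous up to `C = Cmax`. There the integrand is a
constant `v` with `v² = T / (2T + h)`, where `T` is the tangent of the contact angle and `T (T + h)
= n - 2`. So `W` tends to `2πv`, which exceeds `π` exactly when `h < 2T`; this is the bound on `h`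
(`integral_angularSpeed_Cmax`).

Near `C = 0`: heuristically the hypersurface degenerates to a chain of spheres of diameter `π - 2
arctan (h / (n - 1)) < π`. For a proof, follow the point `χ` at which the normal geodesic meets the
axis (`centre`) against the inclination `τ = arctan k`, where `k` is `slope`. With `c = C ^ (1 / (n
- 1))` and `S = supportFn n h` one finds `dχ/dτ = -1 / √(1 - c² / S(τ)²)`. Since `S` is concave and
equals `c` at both ends of the half period, it lies above the chords to any intermediate point of
its graph. Replacing `S` by these chords gives an elementary integral, hence `W_le`, whose bound for
`W / 2` tends to `π / 2 - arctan (h / (n - 1))`.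

The mean curvature is read off from the normal field: the shape operator has eigenvalue `k` along
the orbits and `h - (n - 2) k` along the curve (`hasDerivAt_normal`). -/

theorem analyticOnNhd_dslope {f : ℝ → ℝ} (hf : AnalyticOnNhd ℝ f univ) (a : ℝ) :
    AnalyticOnNhd ℝ (dslope f a) univ := by
  intro x _
  rcases eq_or_ne x a with rfl | hx
  · obtain ⟨p, hp⟩ := hf x trivial
    exact ⟨_, hp.has_fpower_series_dslope_fslope⟩
  · have h1 : AnalyticAt ℝ (fun y => (y - a)⁻¹ * (f y - f a)) x :=
      ((analyticAt_id.sub analyticAt_const).inv (sub_ne_zero.2 hx)).mul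
        ((hf x trivial).sub analyticAt_const)
    exact h1.congr (dslope_eventuallyEq_slope_of_ne f hx).symm

/-- Two divisions by `x - a` with `dslope`: the first quotient vanishes at `a` because `f'(a) = 0`,
so it can be divided again. -/
theorem exists_quadratic_factor {f : ℝ → ℝ} (hf : AnalyticOnNhd ℝ f univ) {a : ℝ}
    (h1 : deriv f a = 0) :
    ∃ q : ℝ → ℝ, AnalyticOnNhd ℝ q univ ∧ (∀ x, f x = f a - (x - a) ^ 2 * q x) ∧
      deriv (deriv f) a = -2 * q a := by
  set p := dslope (dslope f a) a with hp
  have hpa : AnalyticOnNhd ℝ p univ := analyticOnNhd_dslope (analyticOnNhd_dslope hf a) a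
  have key : ∀ x, f x = f a + (x - a) ^ 2 * p x := by
    intro x
    have e1 := sub_smul_dslope f a x
    have e2 := sub_smul_dslope (dslope f a) a x
    rw [dslope_same, h1] at e2
    simp only [smul_eq_mul, sub_zero] at e1 e2
    rw [hp, sq, mul_assoc, e2, e1]
    ring
  refine ⟨fun x => -p x, hpa.neg, fun x => by rw [key x]; ring, ?_⟩
  have hd : ∀ x, HasDerivAt p (deriv p x) x := fun x =>
    (hpa x trivial).differentiableAt.hasDerivAt
  have hf' : deriv f = fun x => 2 * (x - a) * p x + (x - a) ^ 2 * deriv p x := by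
    ext x
    have : HasDerivAt (fun x => f a + (x - a) ^ 2 * p x)
        (2 * (x - a) * p x + (x - a) ^ 2 * deriv p x) x := by
      have h := ((((hasDerivAt_id x).sub_const a).pow 2).mul (hd x)).const_add (f a)
      refine h.congr_deriv ?_
      simp
    rw [← this.deriv]
    exact congrArg (fun g => deriv g x) (funext key)
  have hd2 : HasDerivAt (deriv p) (deriv (deriv p) a) a :=
    (hpa.deriv a trivial).differentiableAt.hasDerivAt
  have h := ((((hasDerivAt_id a).sub_const a).const_mul 2).mul (hd a)).add
    ((((hasDerivAt_id a).sub_const a).pow 2).mul hd2)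
  rw [hf']
  refine (h.congr_deriv ?_).deriv
  simp

/-- Write `f = f x₀ - (x - x₀)² q` and take `w = (x - x₀) √q`. Away from `x₀` the sign of `w'`
follows from `f' = -2 w w'`; at `x₀` one has `w' = √q`. -/
theorem exists_morse_function {f : ℝ → ℝ} {a x₀ b : ℝ} (hf : AnalyticOnNhd ℝ f univ)
    (hx : x₀ ∈ Ioo a b) (h1 : deriv f x₀ = 0) (hpos : ∀ x ∈ Ioo a x₀, 0 < deriv f x)
    (hneg : ∀ x ∈ Ioo x₀ b, deriv f x < 0) (h2 : deriv (deriv f) x₀ < 0) :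
    ∃ w : ℝ → ℝ, ContinuousOn w (Icc a b) ∧ w x₀ = 0 ∧ (∀ x ∈ Icc a b, f x = f x₀ - w x ^ 2) ∧
      ∀ x ∈ Ioo a b, ContDiffAt ℝ ∞ w x ∧ 0 < deriv w x := by
  obtain ⟨q, hq, hfq, hq2⟩ := exists_quadratic_factor hf h1
  have hcf : Continuous f := hf.contDiff (n := 1).continuous
  have hcq : Continuous q := hq.contDiff (n := 1).continuous
  have hmono : StrictMonoOn f (Icc a x₀) := by
    refine strictMonoOn_of_deriv_pos (convex_Icc _ _) hcf.continuousOn ?_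
    rwa [interior_Icc]
  have hanti : StrictAntiOn f (Icc x₀ b) := by
    refine strictAntiOn_of_deriv_neg (convex_Icc _ _) hcf.continuousOn ?_
    rwa [interior_Icc]
  have hlt : ∀ x ∈ Icc a b, x ≠ x₀ → f x < f x₀ := by
    intro x hxx hne
    rcases lt_or_gt_of_ne hne with h | h
    · exact hmono ⟨hxx.1, h.le⟩ ⟨hx.1.le, le_rfl⟩ h
    · exact hanti ⟨le_rfl, hx.2.le⟩ ⟨h.le, hxx.2⟩ h
  -- At `x₀` positivity is the second derivative test. Elsewhere, endpoints included, it is `f x < f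
  -- x₀`.
  have hqpos : ∀ x ∈ Icc a b, 0 < q x := by
    intro x hxx
    rcases eq_or_ne x x₀ with rfl | hne
    · linarith
    · have h3 := hlt x hxx hne
      rw [hfq x] at h3
      have h4 : 0 < (x - x₀) ^ 2 := by
        have := sub_ne_zero.2 hne
        positivity
      by_contra hcon
      nlinarith
  set w : ℝ → ℝ := fun x => (x - x₀) * Real.sqrt (q x) with hw
  have hwsm : ∀ x ∈ Ioo a b, ContDiffAt ℝ ∞ w x := by
    intro x hxx
    have : q x ≠ 0 := (hqpos x ⟨hxx.1.le, hxx.2.le⟩).ne'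
    exact (contDiffAt_id.sub contDiffAt_const).mul ((hq x trivial).contDiffAt.sqrt this)
  have hfw : ∀ x ∈ Icc a b, f x = f x₀ - w x ^ 2 := by
    intro x hxx
    rw [hfq x, hw]
    simp only [mul_pow, Real.sq_sqrt (hqpos x hxx).le]
  refine ⟨w, by fun_prop, by simp [hw], hfw, ?_⟩
  intro x hxx
  refine ⟨hwsm x hxx, ?_⟩
  have hwd : HasDerivAt w (deriv w x) x :=
    ((hwsm x hxx).differentiableAt (by simp)).hasDerivAt
  have hqx := Real.sqrt_pos.2 (hqpos x ⟨hxx.1.le, hxx.2.le⟩)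
  have hder : deriv f x = -(2 * w x * deriv w x) := by
    have e : f =ᶠ[nhds x] fun y => f x₀ - w y ^ 2 := by
      filter_upwards [Icc_mem_nhds hxx.1 hxx.2] with y hy using hfw y hy
    rw [e.deriv_eq]
    refine (((hwd.pow 2).const_sub (f x₀)).congr_deriv ?_).deriv
    simp
  rcases lt_trichotomy x x₀ with h | h | h
  · have h5 := hpos x ⟨hxx.1, h⟩
    have h6 : w x < 0 := mul_neg_of_neg_of_pos (by linarith) hqx
    by_contra hcon
    nlinarith
  · subst h
    have hqd : HasDerivAt (fun y => Real.sqrt (q y)) (deriv (fun y => Real.sqrt (q y)) x) x :=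
      ((hq x trivial).contDiffAt (n := 1).sqrt
        (hqpos x ⟨hxx.1.le, hxx.2.le⟩).ne').differentiableAt (by simp) |>.hasDerivAt
    have e : deriv w x = Real.sqrt (q x) :=
      ((((hasDerivAt_id x).sub_const x).mul hqd).congr_deriv (by simp)).deriv
    rwa [e]
  · have h5 := hneg x ⟨h, hxx.2⟩
    have h6 : 0 < w x := mul_pos (by linarith) hqx
    by_contra hcon
    nlinarith

theorem exists_smooth_inverse {w : ℝ → ℝ} {a b : ℝ} (hab : a < b) (hc : ContinuousOn w (Icc a b))
    (hw : ∀ x ∈ Ioo a b, ContDiffAt ℝ ∞ w x ∧ 0 < deriv w x) :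
    ∃ ς : ℝ → ℝ, (∀ y ∈ Ioo (w a) (w b), ς y ∈ Ioo a b ∧ w (ς y) = y ∧ ContDiffAt ℝ ∞ ς y ∧
      0 < deriv ς y) ∧ ∀ x ∈ Ioo a b, w x ∈ Ioo (w a) (w b) ∧ ς (w x) = x := by
  have hmono : StrictMonoOn w (Icc a b) := by
    refine strictMonoOn_of_deriv_pos (convex_Icc _ _) hc ?_
    rw [interior_Icc]
    exact fun x hx => (hw x hx).2
  have hinj : InjOn w (Ioo a b) := hmono.injOn.mono Ioo_subset_Icc_self
  set e : PartialEquiv ℝ ℝ := InjOn.toPartialEquiv w (Ioo a b) hinj with he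
  have hes : e.source = Ioo a b := rfl
  have hecoe : ∀ x, e x = w x := fun _ => rfl
  have hd : ∀ x ∈ Ioo a b, HasStrictDerivAt w (deriv w x) x := fun x hx =>
    (hw x hx).1.hasStrictDerivAt (by simp)
  have ho : IsOpenMap (e.source.domRestrict e) := by
    rw [isOpenMap_iff_nhds_le]
    rintro ⟨x, hx⟩
    have h1 : Filter.map (Subtype.val : e.source → ℝ) (nhds ⟨x, hx⟩) = nhds x :=
      map_nhds_subtype_coe_eq_nhds hx (isOpen_Ioo.mem_nhds hx)
    have h2 := (hd x hx).map_nhds_eq (hw x hx).2.ne'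
    change nhds (w x) ≤ Filter.map (w ∘ Subtype.val) (nhds _)
    rw [← Filter.map_map, h1, h2]
  set E := OpenPartialHomeomorph.ofContinuousOpenRestrict e
    (fun x hx => (hw x hx).1.continuousAt.continuousWithinAt) ho isOpen_Ioo with hE
  have hsub : Ioo (w a) (w b) ⊆ w '' Ioo a b := intermediate_value_Ioo hab.le hc
  refine ⟨E.symm, fun y hy => ?_, fun x hx => ⟨⟨hmono (left_mem_Icc.2 hab.le)
    (Ioo_subset_Icc_self hx) hx.1, hmono (Ioo_subset_Icc_self hx) (right_mem_Icc.2 hab.le) hx.2⟩,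
    E.left_inv hx⟩⟩
  have hyt : y ∈ E.target := hsub hy
  have h1 : E.symm y ∈ Ioo a b := E.map_target hyt
  have h2 : w (E.symm y) = y := E.right_inv hyt
  have h3 : ContDiffAt ℝ ∞ E.symm y :=
    E.contDiffAt_symm_deriv (hw _ h1).2.ne' hyt (hd _ h1).hasDerivAt (hw _ h1).1
  refine ⟨h1, h2, h3, ?_⟩
  have := E.hasDerivAt_symm hyt (hw _ h1).2.ne' (hd _ h1).hasDerivAt
  rw [this.deriv]
  exact inv_pos.2 (hw _ h1).2

theorem exists_morse_coordinate {f : ℝ → ℝ} {a x₀ b : ℝ} (hf : AnalyticOnNhd ℝ f univ)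
    (hx : x₀ ∈ Ioo a b) (h1 : deriv f x₀ = 0) (hpos : ∀ x ∈ Ioo a x₀, 0 < deriv f x)
    (hneg : ∀ x ∈ Ioo x₀ b, deriv f x < 0) (h2 : deriv (deriv f) x₀ < 0) (hab : f b ≤ f a) :
    ∃ ς : ℝ → ℝ, (∀ y, y ^ 2 < f x₀ - f a → ς y ∈ Ioo a b ∧ f (ς y) = f x₀ - y ^ 2 ∧
      ContDiffAt ℝ ∞ ς y ∧ 0 < deriv ς y) ∧ ς 0 = x₀ ∧
      ∀ s ∈ Ioo a b, f a < f s → ∃ y, y ^ 2 < f x₀ - f a ∧ ς y = s := by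
  obtain ⟨w, hwc, hw0, hfw, hw⟩ := exists_morse_function hf hx h1 hpos hneg h2
  have hlt : a < b := hx.1.trans hx.2
  obtain ⟨ς, hς, hςw⟩ := exists_smooth_inverse hlt hwc hw
  have ha := hfw a (left_mem_Icc.2 hlt.le)
  have hb := hfw b (right_mem_Icc.2 hlt.le)
  have hwx := (hςw x₀ hx).1
  rw [hw0] at hwx
  -- `(w a)² = f x₀ - f a` and, by `hab`, `(w b)²` is at least as large, so the range of `w`
  -- contains the whole symmetric interval around `0` reaching down to `w a`.
  have hmem : ∀ y, y ^ 2 < f x₀ - f a → y ∈ Ioo (w a) (w b) := by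
    intro y hy
    constructor
    · have : -(-w a) < y := (abs_lt.1 (sq_lt_sq₀ (abs_nonneg y) (by linarith [hwx.1])|>.1
        (by rw [sq_abs]; nlinarith))).1
      linarith
    · exact (abs_lt.1 (sq_lt_sq₀ (abs_nonneg y) hwx.2.le|>.1 (by rw [sq_abs]; nlinarith))).2
  refine ⟨ς, fun y hy => ?_, ?_, fun s hs hfs => ⟨w s, ?_, (hςw s hs).2⟩⟩
  · obtain ⟨g1, g2, g3, g4⟩ := hς y (hmem y hy)
    refine ⟨g1, ?_, g3, g4⟩
    rw [hfw _ (Ioo_subset_Icc_self g1), g2]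
  · rw [← hw0]
    exact (hςw x₀ hx).2
  · have := hfw s (Ioo_subset_Icc_self hs)
    linarith

/-! ### The profile functions -/

/-- The derivative of `L n`. -/
def dL (n : ℕ) (s : ℝ) : ℝ :=
  Real.sin s ^ (n - 3) * (((n : ℝ) - 2) * Real.cos s ^ 2 - Real.sin s ^ 2)

/-- The derivative of `R n h C`. -/
def dR (n : ℕ) (h s : ℝ) : ℝ := h * Real.cos s * Real.sin s ^ (n - 2)

theorem hasDerivAt_L {n : ℕ} (hn : 3 ≤ n) (s : ℝ) : HasDerivAt (L n) (dL n s) s := by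
  obtain ⟨j, rfl⟩ : ∃ j, n = j + 3 := ⟨n - 3, by omega⟩
  have h := (Real.hasDerivAt_cos s).mul ((Real.hasDerivAt_sin s).pow (j + 1))
  refine h.congr_deriv ?_
  simp only [dL, Nat.add_sub_cancel, Pi.pow_apply]
  push_cast
  ring

theorem hasDerivAt_R {n : ℕ} (hn : 3 ≤ n) (h C s : ℝ) : HasDerivAt (R n h C) (dR n h s) s := by
  obtain ⟨j, rfl⟩ : ∃ j, n = j + 3 := ⟨n - 3, by omega⟩
  have h1 := (((Real.hasDerivAt_sin s).pow (j + 2)).const_mul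
    (h / (((j + 3 : ℕ) : ℝ) - 1))).const_add C
  refine h1.congr_deriv ?_
  have : (j : ℝ) + 3 - 1 ≠ 0 := by
    have : (0 : ℝ) ≤ j := j.cast_nonneg
    linarith
  simp only [dR, show j + 3 - 2 = j + 1 by omega]
  push_cast
  field_simp
  ring

theorem contDiff_L (n : ℕ) : ContDiff ℝ ∞ (L n) := by
  unfold L; fun_prop

theorem contDiff_R (n : ℕ) (h C : ℝ) : ContDiff ℝ ∞ (R n h C) := by
  unfold R; fun_prop

theorem contactAngle_mem {n : ℕ} (hn : 3 ≤ n) {h : ℝ} (hh : 0 < h) :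
    contactAngle n h ∈ Ioo 0 (Real.pi / 2) := by
  have hn' : (3 : ℝ) ≤ n := by exact_mod_cast hn
  refine ⟨?_, Real.arctan_lt_pi_div_two _⟩
  rw [contactAngle, Real.arctan_pos]
  have := Real.sqrt_nonneg (h ^ 2 + 4 * ((n : ℝ) - 2))
  exact div_pos (by linarith) (by linarith)

theorem tan_contactAngle_pos {n : ℕ} (hn : 3 ≤ n) {h : ℝ} (hh : 0 < h) :
    0 < Real.tan (contactAngle n h) :=
  Real.tan_pos_of_pos_of_lt_pi_div_two (contactAngle_mem hn hh).1 (contactAngle_mem hn hh).2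

theorem tan_contactAngle_eq {n : ℕ} (hn : 3 ≤ n) {h : ℝ} (hh : 0 < h) :
    Real.tan (contactAngle n h) * (Real.tan (contactAngle n h) + h) = n - 2 := by
  have h1 := (eq_contactAngle_iff hn h (contactAngle_mem hn hh)).2 rfl
  rw [← Real.tan_inv_eq_cot] at h1
  have ht := tan_contactAngle_pos hn hh
  field_simp at h1
  linarith

/-- The function `s ↦ L(s) - R(s, 0, h)`, whose superlevel sets are the sets `J`. -/
def gap (n : ℕ) (h s : ℝ) : ℝ := L n s - R n h 0 s

theorem L_sub_R (n : ℕ) (h C s : ℝ) : L n s - R n h C s = gap n h s - C := by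
  simp only [gap, R]; ring

theorem analyticOnNhd_gap (n : ℕ) (h : ℝ) : AnalyticOnNhd ℝ (gap n h) univ := by
  intro x _
  unfold gap L R
  fun_prop

/-- The derivative is `sin ^ (n - 3)` times a quadratic form in `cos` and `sin`, which splits over
the roots `T` and `-(T + h)` for the tangent because `T (T + h) = n - 2`. Only the first factor
changes sign on `(0, π/2)`. -/
theorem deriv_gap {n : ℕ} (hn : 3 ≤ n) {h : ℝ} (hh : 0 < h) :
    deriv (gap n h) = fun s => Real.sin s ^ (n - 3) *
      ((Real.tan (contactAngle n h) * Real.cos s - Real.sin s) *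
        ((Real.tan (contactAngle n h) + h) * Real.cos s + Real.sin s)) := by
  ext s
  have hd : HasDerivAt (gap n h) (dL n s - dR n h s) s :=
    (hasDerivAt_L hn s).sub (hasDerivAt_R hn h 0 s)
  rw [hd.deriv, dL, dR,
    ← tan_contactAngle_eq hn hh, show n - 2 = (n - 3) + 1 by omega]
  ring

theorem tan_mul_cos_sub_sin {n : ℕ} (hn : 3 ≤ n) {h : ℝ} (hh : 0 < h) (s : ℝ) :
    Real.tan (contactAngle n h) * Real.cos s - Real.sin s =
      Real.sin (contactAngle n h - s) / Real.cos (contactAngle n h) := by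
  obtain ⟨h0, h1⟩ := contactAngle_mem hn hh
  have := Real.cos_pos_of_mem_Ioo (x := contactAngle n h) ⟨by linarith, h1⟩
  rw [Real.sin_sub, Real.tan_eq_sin_div_cos]
  field_simp

theorem sin_pos_of_mem {s : ℝ} (hs : s ∈ Ioo 0 (Real.pi / 2)) : 0 < Real.sin s :=
  Real.sin_pos_of_pos_of_lt_pi hs.1 (by linarith [hs.2, Real.pi_pos])

theorem cos_pos_of_mem {s : ℝ} (hs : s ∈ Ioo 0 (Real.pi / 2)) : 0 < Real.cos s :=
  Real.cos_pos_of_mem_Ioo ⟨by linarith [hs.1, Real.pi_pos], hs.2⟩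

theorem deriv_gap_contactAngle {n : ℕ} (hn : 3 ≤ n) {h : ℝ} (hh : 0 < h) :
    deriv (gap n h) (contactAngle n h) = 0 := by
  simp [deriv_gap hn hh, tan_mul_cos_sub_sin hn hh]

theorem deriv_gap_pos {n : ℕ} (hn : 3 ≤ n) {h : ℝ} (hh : 0 < h) {s : ℝ}
    (hs : s ∈ Ioo 0 (contactAngle n h)) : 0 < deriv (gap n h) s := by
  have hc := contactAngle_mem hn hh
  have hs' : s ∈ Ioo 0 (Real.pi / 2) := ⟨hs.1, hs.2.trans hc.2⟩
  have := sin_pos_of_mem hs'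
  have := cos_pos_of_mem hs'
  have := cos_pos_of_mem hc
  have := tan_contactAngle_pos hn hh
  have := Real.sin_pos_of_pos_of_lt_pi (x := contactAngle n h - s) (by linarith [hs.2])
    (by linarith [hs.1, hc.2, Real.pi_pos])
  rw [deriv_gap hn hh]
  simp only [tan_mul_cos_sub_sin hn hh]
  positivity

theorem deriv_gap_neg {n : ℕ} (hn : 3 ≤ n) {h : ℝ} (hh : 0 < h) {s : ℝ}
    (hs : s ∈ Ioo (contactAngle n h) (Real.pi / 2)) : deriv (gap n h) s < 0 := by
  have hc := contactAngle_mem hn hh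
  have hs' : s ∈ Ioo 0 (Real.pi / 2) := ⟨hc.1.trans hs.1, hs.2⟩
  have h1 := sin_pos_of_mem hs'
  have := cos_pos_of_mem hs'
  have h2 := cos_pos_of_mem hc
  have := tan_contactAngle_pos hn hh
  have h3 : Real.sin (contactAngle n h - s) < 0 := Real.sin_neg_of_neg_of_neg_pi_lt
    (by linarith [hs.1]) (by linarith [hs.2, hc.1, Real.pi_pos])
  rw [deriv_gap hn hh]
  simp only [tan_mul_cos_sub_sin hn hh]
  exact mul_neg_of_pos_of_neg (by positivity)
    (mul_neg_of_neg_of_pos (div_neg_of_neg_of_pos h3 h2) (by positivity))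

/-- At the contact angle only the term that differentiates the vanishing factor survives. -/
theorem deriv_deriv_gap {n : ℕ} (hn : 3 ≤ n) {h : ℝ} (hh : 0 < h) :
    deriv (deriv (gap n h)) (contactAngle n h) =
      -(Real.sin (contactAngle n h) ^ (n - 3) * (2 * Real.tan (contactAngle n h) + h)) := by
  have hc := cos_pos_of_mem (contactAngle_mem hn hh)
  set a := contactAngle n h
  have e0 : Real.tan a * Real.cos a - Real.sin a = 0 := by
    rw [tan_mul_cos_sub_sin hn hh]; simp [a]
  have h1 : HasDerivAt (fun s => Real.tan a * Real.cos s - Real.sin s)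
      (Real.tan a * (-Real.sin a) - Real.cos a) a :=
    ((Real.hasDerivAt_cos a).const_mul _).sub (Real.hasDerivAt_sin a)
  have h2 : HasDerivAt (fun s => (Real.tan a + h) * Real.cos s + Real.sin s)
      ((Real.tan a + h) * (-Real.sin a) + Real.cos a) a :=
    ((Real.hasDerivAt_cos a).const_mul _).add (Real.hasDerivAt_sin a)
  have h3 := ((Real.hasDerivAt_sin a).pow (n - 3)).mul (h1.mul h2)
  rw [deriv_gap hn hh]
  refine (h3.congr_deriv ?_).deriv
  simp only [Pi.mul_apply, Pi.pow_apply, e0, zero_mul, mul_zero, zero_add, add_zero]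
  have e1 : Real.sin a = Real.tan a * Real.cos a := by linarith
  have e2 := Real.sin_sq_add_cos_sq a
  rw [e1] at e2
  rw [e1]
  have : Real.cos a ^ 2 * (Real.tan a ^ 2 + 1) = 1 := by linarith
  linear_combination (-(2 * Real.tan a + h) * (Real.tan a * Real.cos a) ^ (n - 3)) * this

theorem gap_zero {n : ℕ} (hn : 3 ≤ n) (h : ℝ) : gap n h 0 = 0 := by
  simp [gap, L, R, show n - 2 ≠ 0 by omega, show n - 1 ≠ 0 by omega]

theorem gap_pi_div_two {n : ℕ} (hn : 3 ≤ n) {h : ℝ} (hh : 0 < h) : gap n h (Real.pi / 2) ≤ 0 := by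
  have hn' : (3 : ℝ) ≤ n := by exact_mod_cast hn
  have : 0 < h / ((n : ℝ) - 1) := div_pos hh (by linarith)
  simp [gap, L, R, this.le]

theorem R_pos {n : ℕ} (hn : 3 ≤ n) {h C s : ℝ} (hh : 0 < h) (hC : 0 < C)
    (hs : s ∈ Ioo 0 (Real.pi / 2)) : 0 < R n h C s := by
  have hn' : (3 : ℝ) ≤ n := by exact_mod_cast hn
  have : 0 < h / ((n : ℝ) - 1) := div_pos hh (by linarith)
  have := sin_pos_of_mem hs
  unfold R
  positivity

theorem L_pos (n : ℕ) {s : ℝ} (hs : s ∈ Ioo 0 (Real.pi / 2)) : 0 < L n s :=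
  mul_pos (cos_pos_of_mem hs) (pow_pos (sin_pos_of_mem hs) _)

theorem mem_J_iff {n : ℕ} (hn : 3 ≤ n) {h C s : ℝ} (hh : 0 < h) (hC : 0 < C) :
    s ∈ J n h C ↔ s ∈ Ioo 0 (Real.pi / 2) ∧ C < gap n h s := by
  refine and_congr_right fun hs => ?_
  rw [abs_of_pos (R_pos hn hh hC hs), ← sub_pos, L_sub_R, sub_pos]

theorem exists_gap_coordinate {n : ℕ} (hn : 3 ≤ n) {h : ℝ} (hh : 0 < h) :
    ∃ ς : ℝ → ℝ, (∀ y, y ^ 2 < Cmax n h → ς y ∈ Ioo 0 (Real.pi / 2) ∧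
      gap n h (ς y) = Cmax n h - y ^ 2 ∧ ContDiffAt ℝ ∞ ς y ∧ 0 < deriv ς y) ∧
      ς 0 = contactAngle n h ∧
      ∀ s ∈ Ioo 0 (Real.pi / 2), 0 < gap n h s → ∃ y, y ^ 2 < Cmax n h ∧ ς y = s := by
  have hc := contactAngle_mem hn hh
  have h2 : deriv (deriv (gap n h)) (contactAngle n h) < 0 := by
    rw [deriv_deriv_gap hn hh]
    have := sin_pos_of_mem hc
    have := tan_contactAngle_pos hn hh
    exact neg_neg_of_pos (by positivity)
  have := exists_morse_coordinate (analyticOnNhd_gap n h) hc (deriv_gap_contactAngle hn hh)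
    (fun x hx => deriv_gap_pos hn hh hx) (fun x hx => deriv_gap_neg hn hh hx) h2
    ((gap_pi_div_two hn hh).trans_eq (gap_zero hn h).symm)
  rw [gap_zero hn h, sub_zero] at this
  exact this

/-- A smooth parametrization of the interval `(0, π/2)` near the contact angle in which `gap n h`
is `Cmax n h - y ^ 2`. -/
structure IsGapCoordinate (n : ℕ) (h : ℝ) (ς : ℝ → ℝ) : Prop where
  three_le : 3 ≤ n
  pos : 0 < h
  mem : ∀ y, y ^ 2 < Cmax n h → ς y ∈ Ioo 0 (Real.pi / 2)
  gap_eq : ∀ y, y ^ 2 < Cmax n h → gap n h (ς y) = Cmax n h - y ^ 2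
  contDiffAt : ∀ y, y ^ 2 < Cmax n h → ContDiffAt ℝ ∞ ς y
  deriv_pos : ∀ y, y ^ 2 < Cmax n h → 0 < deriv ς y
  zero : ς 0 = contactAngle n h
  surj : ∀ s ∈ Ioo 0 (Real.pi / 2), 0 < gap n h s → ∃ y, y ^ 2 < Cmax n h ∧ ς y = s

theorem exists_isGapCoordinate {n : ℕ} (hn : 3 ≤ n) {h : ℝ} (hh : 0 < h) :
    ∃ ς : ℝ → ℝ, IsGapCoordinate n h ς := by
  obtain ⟨ς, h1, h2, h3⟩ := exists_gap_coordinate hn hh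
  exact ⟨ς, hn, hh, fun y hy => (h1 y hy).1, fun y hy => (h1 y hy).2.1,
    fun y hy => (h1 y hy).2.2.1, fun y hy => (h1 y hy).2.2.2, h2, h3⟩

theorem Cmax_pos {n : ℕ} (hn : 3 ≤ n) {h : ℝ} (hh : 0 < h) : 0 < Cmax n h := by
  have hc := contactAngle_mem hn hh
  have hmono : StrictMonoOn (gap n h) (Icc 0 (contactAngle n h)) := by
    refine strictMonoOn_of_deriv_pos (convex_Icc _ _)
      ((analyticOnNhd_gap n h).contDiff (n := 1)).continuous.continuousOn ?_
    rw [interior_Icc]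
    exact fun x hx => deriv_gap_pos hn hh hx
  have := hmono (left_mem_Icc.2 hc.1.le) (right_mem_Icc.2 hc.1.le) hc.1
  rwa [gap_zero hn] at this

namespace IsGapCoordinate

variable {n : ℕ} {h : ℝ} {ς : ℝ → ℝ}

theorem hasDerivAt (H : IsGapCoordinate n h ς) {y : ℝ} (hy : y ^ 2 < Cmax n h) :
    HasDerivAt ς (deriv ς y) y :=
  ((H.contDiffAt y hy).differentiableAt (by simp)).hasDerivAt

theorem isOpen_domain (c : ℝ) : IsOpen {y : ℝ | y ^ 2 < c} :=
  isOpen_lt (by fun_prop) continuous_const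

theorem contDiffAt_deriv (H : IsGapCoordinate n h ς) {y : ℝ} (hy : y ^ 2 < Cmax n h) :
    ContDiffAt ℝ ∞ (deriv ς) y := by
  have h1 : ContDiffOn ℝ ∞ ς {y : ℝ | y ^ 2 < Cmax n h} := fun z hz =>
    (H.contDiffAt z hz).contDiffWithinAt
  have h2 := ((contDiffOn_infty_iff_deriv_of_isOpen (isOpen_domain _)).1 h1).2
  exact h2.contDiffAt ((isOpen_domain _).mem_nhds hy)

theorem deriv_gap_mul (H : IsGapCoordinate n h ς) {y : ℝ} (hy : y ^ 2 < Cmax n h) :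
    (dL n (ς y) - dR n h (ς y)) * deriv ς y = -(2 * y) := by
  have h1 : HasDerivAt (gap n h) (dL n (ς y) - dR n h (ς y)) (ς y) :=
    (hasDerivAt_L H.three_le _).sub (hasDerivAt_R H.three_le h 0 _)
  have h2 := h1.comp y (H.hasDerivAt hy)
  have h3 : HasDerivAt (fun y : ℝ => Cmax n h - y ^ 2) (-(2 * y)) y :=
    (((hasDerivAt_id y).pow 2).const_sub _).congr_deriv (by simp)
  refine h2.unique (h3.congr_of_eventuallyEq ?_)
  filter_upwards [(isOpen_domain _).mem_nhds hy] with z hz using H.gap_eq z hz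

/-- Differentiating `gap (ς y) = Cmax - y²` twice at the maximum determines `ς'(0)`, and with it the
limit of the period as `C → Cmax`. -/
theorem deriv_zero_sq (H : IsGapCoordinate n h ς) :
    deriv (deriv (gap n h)) (contactAngle n h) * deriv ς 0 ^ 2 = -2 := by
  have h0 : (0 : ℝ) ^ 2 < Cmax n h := by simpa using Cmax_pos H.three_le H.pos
  have hg := (analyticOnNhd_gap n h).deriv.contDiff (n := 1)
  have h1 : HasDerivAt (deriv (gap n h)) (deriv (deriv (gap n h)) (ς 0)) (ς 0) :=
    (hg.differentiable (by simp)).differentiableAt.hasDerivAt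
  have h2 := (h1.comp 0 (H.hasDerivAt h0)).mul
    ((H.contDiffAt_deriv h0).differentiableAt (by simp)).hasDerivAt
  have h3 : HasDerivAt (fun y : ℝ => -(2 * y)) (-2) 0 :=
    (((hasDerivAt_id (0 : ℝ)).const_mul 2).neg).congr_deriv (by simp)
  have h4 := h2.unique (h3.congr_of_eventuallyEq ?_)
  · simp only [Function.comp_apply, H.zero, deriv_gap_contactAngle H.three_le H.pos] at h4
    linear_combination h4
  · filter_upwards [(isOpen_domain _).mem_nhds h0] with z hz
    rw [← H.deriv_gap_mul hz]
    have : HasDerivAt (gap n h) (dL n (ς z) - dR n h (ς z)) (ς z) :=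
      (hasDerivAt_L H.three_le _).sub (hasDerivAt_R H.three_le h 0 _)
    simp [this.deriv]

theorem strictMonoOn (H : IsGapCoordinate n h ς) :
    StrictMonoOn ς {y : ℝ | y ^ 2 < Cmax n h} := by
  have hset : {y : ℝ | y ^ 2 < Cmax n h} = Ioo (-√(Cmax n h)) (√(Cmax n h)) := by
    ext y
    rw [mem_ofPred_eq, mem_Ioo, ← abs_lt, Real.lt_sqrt (abs_nonneg y), sq_abs]
  refine strictMonoOn_of_deriv_pos (hset ▸ convex_Ioo _ _)
    (fun y hy => (H.contDiffAt y hy).continuousAt.continuousWithinAt) fun y hy => ?_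
  rw [(isOpen_domain _).interior_eq] at hy
  exact H.deriv_pos y hy

end IsGapCoordinate

/-! ### A regular parametrization of the generating curve -/

/-- A smooth regular parametrization of the global generating curve by a variable `φ`, in which the
local curve corresponds to `(-π/2, π/2)` and its first reflection to `(π/2, 3π/2)`. The latitude is
`X` and the phase is `Θ`. -/
structure ProfileCurve (n : ℕ) (h C : ℝ) where
  /-- The latitude. -/
  X : ℝ → ℝ
  /-- The smooth function `± √(L² - R²)` along the curve. -/
  D : ℝ → ℝ
  /-- The time change of the parametrization. -/
  μ : ℝ → ℝ
  /-- The phase. -/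
  Θ : ℝ → ℝ
  contDiff_X : ContDiff ℝ ∞ X
  contDiff_D : ContDiff ℝ ∞ D
  contDiff_Θ : ContDiff ℝ ∞ Θ
  mem : ∀ φ, X φ ∈ Ioo 0 (Real.pi / 2)
  μ_pos : ∀ φ, 0 < μ φ
  D_sq : ∀ φ, D φ ^ 2 = L n (X φ) ^ 2 - R n h C (X φ) ^ 2
  D_pos : ∀ φ ∈ Ioo (-(Real.pi / 2)) (Real.pi / 2), 0 < D φ
  D_left : D (-(Real.pi / 2)) = 0
  D_right : D (Real.pi / 2) = 0
  hasDerivAt_X : ∀ φ, HasDerivAt X (D φ * μ φ) φ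
  hasDerivAt_D : ∀ φ, HasDerivAt D
    ((L n (X φ) * dL n (X φ) - R n h C (X φ) * dR n h (X φ)) * μ φ) φ
  hasDerivAt_Θ : ∀ φ, HasDerivAt Θ (R n h C (X φ) * μ φ / Real.cos (X φ)) φ
  X_periodic : Function.Periodic X (2 * Real.pi)
  D_periodic : Function.Periodic D (2 * Real.pi)
  Θ_add_two_pi : ∀ φ, Θ (φ + 2 * Real.pi) = Θ φ + W n h C
  X_symm : ∀ φ, X (Real.pi - φ) = X φ
  Θ_symm : ∀ φ, Θ (Real.pi - φ) = W n h C - Θ φ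
  J_eq : J n h C = X '' Ioo (-(Real.pi / 2)) (Real.pi / 2)
  phase_eq : ∀ φ ∈ Icc (-(Real.pi / 2)) (Real.pi / 2), phase n h C (X φ) = Θ φ

/-- The latitude of the point with parameter `φ`. -/
def latitude (n : ℕ) (h : ℝ) (ς : ℝ → ℝ) (C φ : ℝ) : ℝ := ς (√(Cmax n h - C) * Real.sin φ)

/-- The time change of the regular parametrization. -/
def timeChange (n : ℕ) (h : ℝ) (ς : ℝ → ℝ) (C φ : ℝ) : ℝ :=
  deriv ς (√(Cmax n h - C) * Real.sin φ) /
    √(L n (latitude n h ς C φ) + R n h C (latitude n h ς C φ))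

/-- The angular speed of the regular parametrization. -/
def angularSpeed (n : ℕ) (h : ℝ) (ς : ℝ → ℝ) (C φ : ℝ) : ℝ :=
  R n h C (latitude n h ς C φ) * timeChange n h ς C φ / Real.cos (latitude n h ς C φ)

/-- The signed square root of `L² - R²` in the regular parametrization. -/
def radialSpeed (n : ℕ) (h : ℝ) (ς : ℝ → ℝ) (C φ : ℝ) : ℝ :=
  √(Cmax n h - C) * Real.cos φ * √(L n (latitude n h ς C φ) + R n h C (latitude n h ς C φ))

/-! ### Smoothness and derivatives of the regular parametrization -/

namespace IsGapCoordinate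

variable {n : ℕ} {h C : ℝ} {ς : ℝ → ℝ}

/-- The endpoint `C = Cmax` is admitted: the amplitude vanishes there and nothing degenerates, so
the limit of the period becomes an ordinary value. -/
theorem sq_lt (hC : C ∈ Ioc 0 (Cmax n h)) (φ : ℝ) :
    (√(Cmax n h - C) * Real.sin φ) ^ 2 < Cmax n h := by
  rw [mul_pow, Real.sq_sqrt (by linarith [hC.2])]
  nlinarith [Real.sin_sq_le_one φ, hC.1, hC.2, sq_nonneg (Real.sin φ)]

theorem latitude_mem (H : IsGapCoordinate n h ς) (hC : C ∈ Ioc 0 (Cmax n h)) (φ : ℝ) :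
    latitude n h ς C φ ∈ Ioo 0 (Real.pi / 2) :=
  H.mem _ (sq_lt hC φ)

theorem L_add_R_pos (H : IsGapCoordinate n h ς) (hC : C ∈ Ioc 0 (Cmax n h)) (φ : ℝ) :
    0 < L n (latitude n h ς C φ) + R n h C (latitude n h ς C φ) :=
  add_pos (L_pos n (H.latitude_mem hC φ)) (R_pos H.three_le H.pos hC.1 (H.latitude_mem hC φ))

theorem timeChange_pos (H : IsGapCoordinate n h ς) (hC : C ∈ Ioc 0 (Cmax n h)) (φ : ℝ) :
    0 < timeChange n h ς C φ :=
  div_pos (H.deriv_pos _ (sq_lt hC φ)) (Real.sqrt_pos.2 (H.L_add_R_pos hC φ))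

theorem contDiff_latitude (H : IsGapCoordinate n h ς) (hC : C ∈ Ioc 0 (Cmax n h)) :
    ContDiff ℝ ∞ (latitude n h ς C) :=
  contDiff_iff_contDiffAt.2 fun φ =>
    (H.contDiffAt _ (sq_lt hC φ)).comp φ (contDiffAt_const.mul Real.contDiff_sin.contDiffAt)

theorem contDiff_sqrt (H : IsGapCoordinate n h ς) (hC : C ∈ Ioc 0 (Cmax n h)) :
    ContDiff ℝ ∞ fun φ => √(L n (latitude n h ς C φ) + R n h C (latitude n h ς C φ)) :=
  (((contDiff_L n).comp (H.contDiff_latitude hC)).add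
    ((contDiff_R n h C).comp (H.contDiff_latitude hC))).sqrt fun φ => (H.L_add_R_pos hC φ).ne'

theorem contDiff_timeChange (H : IsGapCoordinate n h ς) (hC : C ∈ Ioc 0 (Cmax n h)) :
    ContDiff ℝ ∞ (timeChange n h ς C) := by
  refine ContDiff.div (contDiff_iff_contDiffAt.2 fun φ => ?_) (H.contDiff_sqrt hC) fun φ =>
    (Real.sqrt_pos.2 (H.L_add_R_pos hC φ)).ne'
  exact (H.contDiffAt_deriv (sq_lt hC φ)).comp φ
    (contDiffAt_const.mul Real.contDiff_sin.contDiffAt)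

theorem contDiff_angularSpeed (H : IsGapCoordinate n h ς) (hC : C ∈ Ioc 0 (Cmax n h)) :
    ContDiff ℝ ∞ (angularSpeed n h ς C) :=
  ContDiff.div (((contDiff_R n h C).comp (H.contDiff_latitude hC)).mul
    (H.contDiff_timeChange hC)) (Real.contDiff_cos.comp (H.contDiff_latitude hC)) fun φ =>
      (cos_pos_of_mem (H.latitude_mem hC φ)).ne'

/-- In this coordinate `L - R = (Cmax - C) cos² φ`, so `L² - R²` is a square times the positive
function `L + R` and has a smooth root that changes sign with `cos φ`. -/
theorem radialSpeed_sq (H : IsGapCoordinate n h ς) (hC : C ∈ Ioc 0 (Cmax n h)) (φ : ℝ) :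
    radialSpeed n h ς C φ ^ 2 =
      L n (latitude n h ς C φ) ^ 2 - R n h C (latitude n h ς C φ) ^ 2 := by
  have h1 := H.gap_eq _ (sq_lt hC φ)
  have h2 := L_sub_R n h C (latitude n h ς C φ)
  have h3 := Real.sq_sqrt (sub_nonneg.2 hC.2)
  change gap n h (latitude n h ς C φ) = _ at h1
  rw [mul_pow, h3] at h1
  rw [radialSpeed, mul_pow, Real.sq_sqrt (H.L_add_R_pos hC φ).le, mul_pow, h3, Real.cos_sq']
  linear_combination (-(L n (latitude n h ς C φ) + R n h C (latitude n h ς C φ))) * (h1 + h2)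

theorem hasDerivAt_latitude (H : IsGapCoordinate n h ς) (hC : C ∈ Ioc 0 (Cmax n h)) (φ : ℝ) :
    HasDerivAt (latitude n h ς C) (radialSpeed n h ς C φ * timeChange n h ς C φ) φ := by
  have h1 := (H.hasDerivAt (sq_lt hC φ)).comp φ
    ((Real.hasDerivAt_sin φ).const_mul (√(Cmax n h - C)))
  refine h1.congr_deriv ?_
  have := (Real.sqrt_pos.2 (H.L_add_R_pos hC φ)).ne'
  rw [radialSpeed, timeChange]
  field_simp

/-- Differentiating `D² = L² - R²` would require division by `D`, which vanishes at the turning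
points. The explicit product is differentiated instead, and `deriv_gap_mul` accounts for the `sin φ`
term. -/
theorem hasDerivAt_radialSpeed (H : IsGapCoordinate n h ς) (hC : C ∈ Ioc 0 (Cmax n h)) (φ : ℝ) :
    HasDerivAt (radialSpeed n h ς C)
      ((L n (latitude n h ς C φ) * dL n (latitude n h ς C φ) -
        R n h C (latitude n h ς C φ) * dR n h (latitude n h ς C φ)) * timeChange n h ς C φ) φ := by
  have hX := H.hasDerivAt_latitude hC φ
  have hLR := (((hasDerivAt_L H.three_le _).comp φ hX).add
    ((hasDerivAt_R H.three_le h C _).comp φ hX)).sqrt (H.L_add_R_pos hC φ).ne'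
  have h1 := ((Real.hasDerivAt_cos φ).const_mul (√(Cmax n h - C))).mul hLR
  refine h1.congr_deriv ?_
  have h2 := H.deriv_gap_mul (sq_lt hC φ)
  have h3 := H.radialSpeed_sq hC φ
  have hq := (Real.sqrt_pos.2 (H.L_add_R_pos hC φ)).ne'
  have hq2 := Real.sq_sqrt (H.L_add_R_pos hC φ).le
  have hg : deriv ς (√(Cmax n h - C) * Real.sin φ) = timeChange n h ς C φ *
      √(L n (latitude n h ς C φ) + R n h C (latitude n h ς C φ)) := by
    rw [timeChange]; field_simp
  change (dL n (latitude n h ς C φ) - dR n h (latitude n h ς C φ)) * _ = _ at h2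
  rw [hg] at h2
  simp only [Function.comp_apply, Pi.add_apply]
  rw [radialSpeed] at h3 ⊢
  set q := √(L n (latitude n h ς C φ) + R n h C (latitude n h ς C φ))
  set A := √(Cmax n h - C)
  set l := L n (latitude n h ς C φ)
  set r := R n h C (latitude n h ς C φ)
  have hlr : l + r ≠ 0 := (H.L_add_R_pos hC φ).ne'
  have h5 : (A * Real.cos φ) ^ 2 = l - r := by
    refine mul_right_cancel₀ hlr ?_
    rw [mul_pow, hq2] at h3
    linarith
  field_simp
  linear_combination (-q) * h2 + timeChange n h ς C φ * (dL n (latitude n h ς C φ) +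
    dR n h (latitude n h ς C φ)) * h5 + (dL n (latitude n h ς C φ) -
    dR n h (latitude n h ς C φ)) * timeChange n h ς C φ * hq2

theorem strictMonoOn_latitude (H : IsGapCoordinate n h ς) (hC : C ∈ Ioo 0 (Cmax n h)) :
    StrictMonoOn (latitude n h ς C) (Icc (-(Real.pi / 2)) (Real.pi / 2)) := by
  intro a ha b hb hab
  refine H.strictMonoOn (sq_lt ⟨hC.1, hC.2.le⟩ a) (sq_lt ⟨hC.1, hC.2.le⟩ b) ?_
  exact mul_lt_mul_of_pos_left (Real.strictMonoOn_sin ha hb hab)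
    (Real.sqrt_pos.2 (sub_pos.2 hC.2))

theorem radialSpeed_pos (H : IsGapCoordinate n h ς) (hC : C ∈ Ioo 0 (Cmax n h)) {φ : ℝ}
    (hφ : φ ∈ Ioo (-(Real.pi / 2)) (Real.pi / 2)) : 0 < radialSpeed n h ς C φ :=
  mul_pos (mul_pos (Real.sqrt_pos.2 (sub_pos.2 hC.2)) (Real.cos_pos_of_mem_Ioo hφ))
    (Real.sqrt_pos.2 (H.L_add_R_pos ⟨hC.1, hC.2.le⟩ φ))

theorem J_eq_image (H : IsGapCoordinate n h ς) (hC : C ∈ Ioo 0 (Cmax n h)) :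
    J n h C = latitude n h ς C '' Ioo (-(Real.pi / 2)) (Real.pi / 2) := by
  have hC' : C ∈ Ioc 0 (Cmax n h) := ⟨hC.1, hC.2.le⟩
  have hA := Real.sqrt_pos.2 (sub_pos.2 hC.2)
  have hA2 := Real.sq_sqrt (sub_pos.2 hC.2).le
  ext s
  rw [mem_J_iff H.three_le H.pos hC.1]
  constructor
  · rintro ⟨hs, hs2⟩
    obtain ⟨y, hy, rfl⟩ := H.surj s hs (hC.1.trans hs2)
    rw [H.gap_eq y hy] at hs2
    have hy2 : |y| < √(Cmax n h - C) := by
      rw [Real.lt_sqrt (abs_nonneg y), sq_abs]; linarith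
    have hy3 : |y / √(Cmax n h - C)| < 1 := by
      rw [abs_div, abs_of_pos hA, div_lt_one hA]; exact hy2
    refine ⟨Real.arcsin (y / √(Cmax n h - C)), ⟨Real.neg_pi_div_two_lt_arcsin.2 (abs_lt.1 hy3).1,
      Real.arcsin_lt_pi_div_two.2 (abs_lt.1 hy3).2⟩, ?_⟩
    rw [latitude, Real.sin_arcsin (abs_lt.1 hy3).1.le (abs_lt.1 hy3).2.le, mul_div_cancel₀ _ hA.ne']
  · rintro ⟨φ, hφ, rfl⟩
    refine ⟨H.latitude_mem hC' φ, ?_⟩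
    have h1 := H.radialSpeed_pos hC hφ
    have h2 := H.radialSpeed_sq hC' φ
    have h3 := H.L_add_R_pos hC' φ
    rw [← sub_pos, ← L_sub_R]
    have : 0 < radialSpeed n h ς C φ ^ 2 := by positivity
    by_contra hcon
    nlinarith

theorem J_inter_Iio (H : IsGapCoordinate n h ς) (hC : C ∈ Ioo 0 (Cmax n h)) {φ : ℝ}
    (hφ : φ ∈ Icc (-(Real.pi / 2)) (Real.pi / 2)) :
    J n h C ∩ Iio (latitude n h ς C φ) = latitude n h ς C '' Ioo (-(Real.pi / 2)) φ := by
  have hm := H.strictMonoOn_latitude hC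
  rw [H.J_eq_image hC]
  ext s
  constructor
  · rintro ⟨⟨t, ht, rfl⟩, hlt⟩
    exact ⟨t, ⟨ht.1, (hm.lt_iff_lt ⟨ht.1.le, ht.2.le⟩ hφ).1 hlt⟩, rfl⟩
  · rintro ⟨t, ht, rfl⟩
    exact ⟨⟨t, ⟨ht.1, ht.2.trans_le hφ.2⟩, rfl⟩, hm ⟨ht.1.le, (ht.2.trans_le hφ.2).le⟩ hφ ht.2⟩

/-- The Jacobian `D μ` of the substitution cancels the singular factor `1 / √(L² - R²) = 1 / D`. -/
theorem abs_deriv_smul_phaseSpeed (H : IsGapCoordinate n h ς) (hC : C ∈ Ioo 0 (Cmax n h)) {φ : ℝ}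
    (hφ : φ ∈ Ioo (-(Real.pi / 2)) (Real.pi / 2)) :
    |radialSpeed n h ς C φ * timeChange n h ς C φ| • phaseSpeed n h C (latitude n h ς C φ) =
      angularSpeed n h ς C φ := by
  have hC' : C ∈ Ioc 0 (Cmax n h) := ⟨hC.1, hC.2.le⟩
  have h1 := H.radialSpeed_pos hC hφ
  have h2 := H.timeChange_pos hC' φ
  have h3 := cos_pos_of_mem (H.latitude_mem hC' φ)
  rw [abs_of_pos (mul_pos h1 h2), phaseSpeed, ← H.radialSpeed_sq hC', Real.sqrt_sq h1.le,
    angularSpeed, smul_eq_mul]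
  field_simp

theorem integral_phaseSpeed_image (H : IsGapCoordinate n h ς) (hC : C ∈ Ioo 0 (Cmax n h)) {φ : ℝ}
    (hφ : φ ∈ Icc (-(Real.pi / 2)) (Real.pi / 2)) :
    ∫ s in latitude n h ς C '' Ioo (-(Real.pi / 2)) φ, phaseSpeed n h C s =
      ∫ t in (-(Real.pi / 2))..φ, angularSpeed n h ς C t := by
  have hC' : C ∈ Ioc 0 (Cmax n h) := ⟨hC.1, hC.2.le⟩
  have hsub : Ioo (-(Real.pi / 2)) φ ⊆ Ioo (-(Real.pi / 2)) (Real.pi / 2) :=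
    Ioo_subset_Ioo_right hφ.2
  rw [integral_image_eq_integral_abs_deriv_smul measurableSet_Ioo
    (fun t _ => (H.hasDerivAt_latitude hC' t).hasDerivWithinAt)
    ((H.strictMonoOn_latitude hC).injOn.mono (hsub.trans Ioo_subset_Icc_self)),
    intervalIntegral.integral_of_le hφ.1, integral_Ioc_eq_integral_Ioo]
  exact setIntegral_congr_fun measurableSet_Ioo fun t ht =>
    H.abs_deriv_smul_phaseSpeed hC (hsub ht)

theorem integrableOn_phaseSpeed (H : IsGapCoordinate n h ς) (hC : C ∈ Ioo 0 (Cmax n h)) :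
    IntegrableOn (phaseSpeed n h C) (J n h C) := by
  have hC' : C ∈ Ioc 0 (Cmax n h) := ⟨hC.1, hC.2.le⟩
  rw [H.J_eq_image hC, integrableOn_image_iff_integrableOn_abs_deriv_smul measurableSet_Ioo
    (fun t _ => (H.hasDerivAt_latitude hC' t).hasDerivWithinAt)
    ((H.strictMonoOn_latitude hC).injOn.mono Ioo_subset_Icc_self),
    integrableOn_congr_fun (fun t ht => H.abs_deriv_smul_phaseSpeed hC ht) measurableSet_Ioo]
  exact ((H.contDiff_angularSpeed hC').continuous.integrableOn_Icc).mono_set Ioo_subset_Icc_self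

theorem W_eq (H : IsGapCoordinate n h ς) (hC : C ∈ Ioo 0 (Cmax n h)) :
    W n h C = 2 * ∫ t in (-(Real.pi / 2))..(Real.pi / 2), angularSpeed n h ς C t := by
  rw [W, H.J_eq_image hC, H.integral_phaseSpeed_image hC]
  exact right_mem_Icc.2 (by linarith [Real.pi_pos])

theorem latitude_symm (φ : ℝ) : latitude n h ς C (Real.pi - φ) = latitude n h ς C φ := by
  rw [latitude, Real.sin_pi_sub, latitude]

theorem angularSpeed_symm (φ : ℝ) :
    angularSpeed n h ς C (Real.pi - φ) = angularSpeed n h ς C φ := by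
  rw [angularSpeed, timeChange, latitude_symm, Real.sin_pi_sub, angularSpeed, timeChange]

/-- The regular parametrization obtained from a gap coordinate. -/
def profileCurve (H : IsGapCoordinate n h ς) (hC : C ∈ Ioo 0 (Cmax n h)) : ProfileCurve n h C :=
  have hC' : C ∈ Ioc 0 (Cmax n h) := ⟨hC.1, hC.2.le⟩
  have hcont := (H.contDiff_angularSpeed hC').continuous
  have hint : ∀ a b, IntervalIntegrable (angularSpeed n h ς C) volume a b := fun a b =>
    hcont.intervalIntegrable a b
  have hderiv : ∀ φ, HasDerivAt
      (fun φ => ∫ t in (-(Real.pi / 2))..φ, angularSpeed n h ς C t) (angularSpeed n h ς C φ) φ :=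
    fun φ => hcont.integral_hasStrictDerivAt _ φ |>.hasDerivAt
  -- The angular speed depends on `φ` through `sin φ` only, hence is symmetric about `π / 2`.
  have hsymm : ∀ φ, ∫ t in (-(Real.pi / 2))..(Real.pi - φ), angularSpeed n h ς C t =
      W n h C - ∫ t in (-(Real.pi / 2))..φ, angularSpeed n h ς C t := fun φ => by
    have h1 : ∫ t in (Real.pi / 2)..(Real.pi - φ), angularSpeed n h ς C t =
        ∫ t in φ..(Real.pi / 2), angularSpeed n h ς C t := by
      have := intervalIntegral.integral_comp_sub_left (a := φ) (b := Real.pi / 2)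
        (angularSpeed n h ς C) Real.pi
      rw [sub_half] at this
      rw [← this]
      simp only [angularSpeed_symm]
    rw [H.W_eq hC, ← intervalIntegral.integral_add_adjacent_intervals (hint _ (Real.pi / 2))
      (hint _ (Real.pi - φ)), h1]
    have := intervalIntegral.integral_add_adjacent_intervals (hint (-(Real.pi / 2)) φ)
      (hint φ (Real.pi / 2))
    linarith
  { X := latitude n h ς C
    D := radialSpeed n h ς C
    μ := timeChange n h ς C
    Θ := fun φ => ∫ t in (-(Real.pi / 2))..φ, angularSpeed n h ς C t
    contDiff_X := H.contDiff_latitude hC'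
    contDiff_D := (contDiff_const.mul Real.contDiff_cos).mul (H.contDiff_sqrt hC')
    contDiff_Θ := by
      rw [contDiff_infty_iff_deriv]
      refine ⟨fun φ => (hderiv φ).differentiableAt, ?_⟩
      rw [funext fun φ => (hderiv φ).deriv]
      exact H.contDiff_angularSpeed hC'
    mem := H.latitude_mem hC'
    μ_pos := H.timeChange_pos hC'
    D_sq := H.radialSpeed_sq hC'
    D_pos := fun φ hφ => H.radialSpeed_pos hC hφ
    D_left := by simp [radialSpeed]
    D_right := by simp [radialSpeed]
    hasDerivAt_X := H.hasDerivAt_latitude hC'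
    hasDerivAt_D := H.hasDerivAt_radialSpeed hC'
    hasDerivAt_Θ := hderiv
    X_periodic := fun φ => by simp [latitude]
    D_periodic := fun φ => by simp [radialSpeed, latitude]
    Θ_add_two_pi := fun φ => by
      have hper : Function.Periodic (angularSpeed n h ς C) (2 * Real.pi) := fun t => by
        simp [angularSpeed, timeChange, latitude]
      have h1 := hper.intervalIntegral_add_eq φ (-(Real.pi / 2))
      have h2 := hsymm (-(Real.pi / 2))
      rw [intervalIntegral.integral_same, sub_zero] at h2
      -- Translating the left end by a period and reflecting it about `π / 2` give the same point,
      -- so `hsymm` evaluates the integral over a full period.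
      rw [show -(Real.pi / 2) + 2 * Real.pi = Real.pi - -(Real.pi / 2) by ring, h2] at h1
      rw [← h1, intervalIntegral.integral_add_adjacent_intervals (hint _ _) (hint _ _)]
    X_symm := latitude_symm
    Θ_symm := hsymm
    J_eq := H.J_eq_image hC
    phase_eq := fun φ hφ => by
      rw [phase, H.J_inter_Iio hC hφ, H.integral_phaseSpeed_image hC hφ] }

end IsGapCoordinate

/-! ### Continuity of the width and its limit at the maximal value of `C` -/

namespace IsGapCoordinate

variable {n : ℕ} {h C : ℝ} {ς : ℝ → ℝ}

theorem continuousOn_integral_angularSpeed (H : IsGapCoordinate n h ς) :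
    ContinuousOn (fun C => ∫ t in (-(Real.pi / 2))..(Real.pi / 2), angularSpeed n h ς C t)
      (Ioc 0 (Cmax n h)) := by
  rw [continuousOn_iff_continuous_domRestrict]
  refine intervalIntegral.continuous_parametric_intervalIntegral_of_continuous'
    (f := fun (C : Ioc 0 (Cmax n h)) t => angularSpeed n h ς C t) ?_ _ _
  have hy : Continuous fun p : Ioc 0 (Cmax n h) × ℝ => √(Cmax n h - p.1) * Real.sin p.2 := by
    fun_prop
  have hX : Continuous fun p : Ioc 0 (Cmax n h) × ℝ => latitude n h ς p.1 p.2 :=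
    continuous_iff_continuousAt.2 fun p =>
      (H.contDiffAt _ (sq_lt p.1.2 p.2)).continuousAt.comp (f := fun p : Ioc 0 (Cmax n h) × ℝ =>
        √(Cmax n h - p.1) * Real.sin p.2) hy.continuousAt
  have hX' : Continuous fun p : Ioc 0 (Cmax n h) × ℝ =>
      deriv ς (√(Cmax n h - p.1) * Real.sin p.2) :=
    continuous_iff_continuousAt.2 fun p =>
      (H.contDiffAt_deriv (sq_lt p.1.2 p.2)).continuousAt.comp
        (f := fun p : Ioc 0 (Cmax n h) × ℝ => √(Cmax n h - p.1) * Real.sin p.2) hy.continuousAt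
  have hR : Continuous fun p : Ioc 0 (Cmax n h) × ℝ => R n h p.1 (latitude n h ς p.1 p.2) := by
    unfold R
    fun_prop
  have hL : Continuous fun p : Ioc 0 (Cmax n h) × ℝ => L n (latitude n h ς p.1 p.2) :=
    (contDiff_L n).continuous.comp hX
  exact (hR.mul (hX'.div (hL.add hR).sqrt fun p =>
    (Real.sqrt_pos.2 (H.L_add_R_pos p.1.2 p.2)).ne')).div (Real.continuous_cos.comp hX) fun p =>
      (cos_pos_of_mem (H.latitude_mem p.1.2 p.2)).ne'

/-- For `C = Cmax` the latitude stays at the contact angle and the angular speed is a constant `v`,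
so the integral is `πv`. The bound on `h` is what makes `v > 1 / 2`. -/
theorem integral_angularSpeed_Cmax (H : IsGapCoordinate n h ς)
    (hh : h ^ 2 < 4 * ((n : ℝ) - 2) / 3) :
    Real.pi / 2 < ∫ t in (-(Real.pi / 2))..(Real.pi / 2), angularSpeed n h ς (Cmax n h) t := by
  have hn := H.three_le
  have hT := tan_contactAngle_pos hn H.pos
  have hTe := tan_contactAngle_eq hn H.pos
  -- Otherwise `T ≤ h / 2`, and `n - 2 = T (T + h) ≤ 3 h² / 4`.
  have hTh : h < 2 * Real.tan (contactAngle n h) := by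
    by_contra! hcon
    nlinarith [H.pos]
  have hmem := contactAngle_mem hn H.pos
  have hsin := sin_pos_of_mem hmem
  have hcos := cos_pos_of_mem hmem
  have hL := L_pos n hmem
  have hd := H.deriv_zero_sq
  have hd0 := H.deriv_pos 0 (by simpa using Cmax_pos hn H.pos)
  rw [deriv_deriv_gap hn H.pos] at hd
  have hRL : R n h (Cmax n h) (contactAngle n h) = L n (contactAngle n h) := by
    have := L_sub_R n h (Cmax n h) (contactAngle n h)
    have e : gap n h (contactAngle n h) = Cmax n h := rfl
    linarith
  set v := deriv ς 0 / √(2 * L n (contactAngle n h)) * L n (contactAngle n h) /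
    Real.cos (contactAngle n h) with hv
  have hconst : ∀ t, angularSpeed n h ς (Cmax n h) t = v := by
    intro t
    simp only [angularSpeed, timeChange, latitude, sub_self, Real.sqrt_zero, zero_mul, H.zero, hRL]
    rw [hv, two_mul]
    ring
  have hv0 : 0 < v := by positivity
  have hv2 : v ^ 2 * (2 * Real.tan (contactAngle n h) + h) = Real.tan (contactAngle n h) := by
    have h2L := Real.sq_sqrt (x := 2 * L n (contactAngle n h)) (by positivity)
    have hs : L n (contactAngle n h) =
      Real.sin (contactAngle n h) ^ (n - 3) * Real.sin (contactAngle n h) *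
        Real.cos (contactAngle n h) := by
      rw [L, show n - 2 = n - 3 + 1 by omega]; ring
    rw [hv, div_pow, mul_pow, div_pow, h2L, hs]
    rw [Real.tan_eq_sin_div_cos] at hd ⊢
    have hp : Real.sin (contactAngle n h) ^ (n - 3) ≠ 0 := by positivity
    field_simp
    field_simp at hd
    linear_combination (-1) * hd
  have hv1 : 1 / 2 < v := by
    by_contra! hcon
    have : v ^ 2 ≤ 1 / 4 := by nlinarith
    nlinarith [H.pos]
  simp only [hconst, intervalIntegral.integral_const, smul_eq_mul]
  nlinarith [Real.pi_pos]

end IsGapCoordinate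

/-! ### An upper bound for the width -/

/-- The function `√((c + l τ)² - c²) / l` is a primitive in `τ` of `1 / √(1 - c² / (c + l τ)²)`. By
`hrc` the speed of `χ` in the variable `τ` is at most this integrand; `ε` carries the orientation.
The root may fail to be differentiable where `τ` vanishes at an end, so derivatives are compared in
the interior only. -/
theorem sub_le_of_affine_comparison {χ χ' τ τ' r : ℝ → ℝ} {a b c l ε : ℝ} (hab : a ≤ b)
    (hc : 0 < c) (hl : 0 < l)
    (hχ : ∀ x, HasDerivAt χ (χ' x) x) (hτ : ∀ x, HasDerivAt τ (τ' x) x)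
    (hpos : ∀ x ∈ Ioo a b, 0 < τ x) (hχ' : ∀ x ∈ Ioo a b, 0 ≤ χ' x)
    (hr : ∀ x ∈ Ioo a b, 0 ≤ r x) (hχτ : ∀ x ∈ Ioo a b, χ' x * r x = ε * τ' x)
    (hrc : ∀ x ∈ Ioo a b, (c + l * τ x) ^ 2 - c ^ 2 ≤ r x ^ 2 * (c + l * τ x) ^ 2) :
    χ b - χ a ≤ ε * (√((c + l * τ b) ^ 2 - c ^ 2) - √((c + l * τ a) ^ 2 - c ^ 2)) / l := by
  have hmono : MonotoneOn (fun x => ε * √((c + l * τ x) ^ 2 - c ^ 2) / l - χ x) (Icc a b) := by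
    have hcτ : Continuous τ := continuous_iff_continuousAt.2 fun x => (hτ x).continuousAt
    have hcχ : Continuous χ := continuous_iff_continuousAt.2 fun x => (hχ x).continuousAt
    refine monotoneOn_of_hasDerivWithinAt_nonneg (convex_Icc _ _) (by fun_prop)
      (f' := fun x => ε * (l * τ' x * (c + l * τ x) / √((c + l * τ x) ^ 2 - c ^ 2)) / l - χ' x)
      ?_ ?_
    · intro x hx
      rw [interior_Icc] at hx
      have h0 : 0 < (c + l * τ x) ^ 2 - c ^ 2 := by
        have := mul_pos hl (hpos x hx)
        nlinarith
      have h1 := ((((((hτ x).const_mul l).const_add c).pow 2).sub_const (c ^ 2)).sqrt h0.ne')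
      have h2 := ((h1.const_mul ε).div_const l).sub (hχ x)
      refine (h2.congr_deriv ?_).hasDerivWithinAt
      simp only [Pi.pow_apply, Nat.cast_ofNat, Nat.add_one_sub_one, pow_one]
      have hS := (Real.sqrt_pos.2 h0).ne'
      field_simp
    · intro x hx
      rw [interior_Icc] at hx
      have hZ : 0 < c + l * τ x := add_pos hc (mul_pos hl (hpos x hx))
      have h0 : 0 < (c + l * τ x) ^ 2 - c ^ 2 := by
        have := mul_pos hl (hpos x hx)
        nlinarith
      have hS := Real.sqrt_pos.2 h0
      have h3 : √((c + l * τ x) ^ 2 - c ^ 2) ≤ r x * (c + l * τ x) := by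
        rw [Real.sqrt_le_left (mul_nonneg (hr x hx) hZ.le), mul_pow]
        exact hrc x hx
      have h4 : ε * (l * τ' x * (c + l * τ x) / √((c + l * τ x) ^ 2 - c ^ 2)) / l =
          χ' x * (r x * (c + l * τ x) / √((c + l * τ x) ^ 2 - c ^ 2)) := by
        have h5 := hχτ x hx
        field_simp
        linear_combination -h5
      have h6 : 1 ≤ r x * (c + l * τ x) / √((c + l * τ x) ^ 2 - c ^ 2) := (one_le_div hS).2 h3
      have := mul_le_mul_of_nonneg_left h6 (hχ' x hx)
      change 0 ≤ _ - _
      rw [h4]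
      linarith
  have := hmono (left_mem_Icc.2 hab) (right_mem_Icc.2 hab) hab
  rw [mul_sub, sub_div]
  simp only at this
  linarith

theorem concaveOn_rpow_mul_rpow {s : Set ℝ} {f g : ℝ → ℝ} {m : ℕ} (hm0 : m ≠ 0)
    (hf : ConcaveOn ℝ s f) (hg : ConcaveOn ℝ s g) (hf0 : ∀ x ∈ s, 0 ≤ f x) (hg0 : ∀ x ∈ s, 0 ≤ g x) :
    ConcaveOn ℝ s fun x => (f x * g x ^ m) ^ (1 / ((m : ℝ) + 1)) := by
  have hm : (0 : ℝ) < (m : ℝ) + 1 := by positivity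
  refine ⟨hf.1, fun x hx y hy a b ha hb hab => ?_⟩
  have hfxy := hf.2 hx hy ha hb hab
  have hgxy := hg.2 hx hy ha hb hab
  simp only [smul_eq_mul] at hfxy hgxy ⊢
  set F := a * f x + b * f y with hF
  set G := a * g x + b * g y with hG
  have hF0 : 0 ≤ F := add_nonneg (mul_nonneg ha (hf0 x hx)) (mul_nonneg hb (hf0 y hy))
  have hG0 : 0 ≤ G := add_nonneg (mul_nonneg ha (hg0 x hx)) (mul_nonneg hb (hg0 y hy))
  have hle : (F * G ^ m) ^ (1 / ((m : ℝ) + 1)) ≤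
      (f (a * x + b * y) * g (a * x + b * y) ^ m) ^ (1 / ((m : ℝ) + 1)) := by
    have := hF0.trans hfxy
    gcongr
  refine le_trans ?_ hle
  have key : ∀ u v : ℝ, 0 ≤ u → 0 ≤ v → (u * v ^ m) ^ (1 / ((m : ℝ) + 1)) =
      u ^ (1 / ((m : ℝ) + 1)) * v ^ ((m : ℝ) / ((m : ℝ) + 1)) := by
    intro u v hu hv
    rw [Real.mul_rpow hu (pow_nonneg hv m), ← Real.rpow_natCast v m, ← Real.rpow_mul hv]
    congr 2
    ring
  have hw : 1 / ((m : ℝ) + 1) + (m : ℝ) / ((m : ℝ) + 1) = 1 := by field_simp; ring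
  rw [key _ _ (hf0 x hx) (hg0 x hx), key _ _ (hf0 y hy) (hg0 y hy), key _ _ hF0 hG0]
  -- Weighted AM-GM for the ratios `u / F` and `v / G`. The right-hand sides at `x` and `y` average
  -- to exactly `F ^ _ * G ^ _`, since the averages of `f / F` and of `g / G` are `1`.
  have hamgm : ∀ u v : ℝ, 0 ≤ u → 0 ≤ v → 0 < F → 0 < G →
      u ^ (1 / ((m : ℝ) + 1)) * v ^ ((m : ℝ) / ((m : ℝ) + 1)) ≤
        (F ^ (1 / ((m : ℝ) + 1)) * G ^ ((m : ℝ) / ((m : ℝ) + 1))) *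
          (1 / ((m : ℝ) + 1) * (u / F) + (m : ℝ) / ((m : ℝ) + 1) * (v / G)) := by
    intro u v hu hv hFp hGp
    have := Real.geom_mean_le_arith_mean2_weighted (w₁ := 1 / ((m : ℝ) + 1))
      (w₂ := (m : ℝ) / ((m : ℝ) + 1)) (p₁ := u / F) (p₂ := v / G) (by positivity) (by positivity)
      (by positivity) (by positivity) hw
    rw [Real.div_rpow hu hFp.le, Real.div_rpow hv hGp.le, div_mul_div_comm, div_le_iff₀
      (by positivity)] at this
    linarith
  have hp1 : 1 / ((m : ℝ) + 1) ≠ 0 := by positivity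
  have hp2 : (m : ℝ) / ((m : ℝ) + 1) ≠ 0 := by positivity
  -- The ratios need `F` and `G` nonzero; if one vanishes, so do both terms on the left.
  rcases hF0.eq_or_lt with hFz | hFp
  · have h1 : a * f x = 0 := by nlinarith [mul_nonneg ha (hf0 x hx), mul_nonneg hb (hf0 y hy)]
    have h2 : b * f y = 0 := by nlinarith [mul_nonneg ha (hf0 x hx), mul_nonneg hb (hf0 y hy)]
    rw [← hFz, Real.zero_rpow hp1, zero_mul]
    rcases mul_eq_zero.1 h1 with h1 | h1 <;> rcases mul_eq_zero.1 h2 with h2 | h2 <;>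
      simp only [h1, h2, Real.zero_rpow hp1, zero_mul, mul_zero, add_zero, le_refl]
  rcases hG0.eq_or_lt with hGz | hGp
  · have h1 : a * g x = 0 := by nlinarith [mul_nonneg ha (hg0 x hx), mul_nonneg hb (hg0 y hy)]
    have h2 : b * g y = 0 := by nlinarith [mul_nonneg ha (hg0 x hx), mul_nonneg hb (hg0 y hy)]
    rw [← hGz, Real.zero_rpow hp2, mul_zero]
    rcases mul_eq_zero.1 h1 with h1 | h1 <;> rcases mul_eq_zero.1 h2 with h2 | h2 <;>
      simp only [h1, h2, Real.zero_rpow hp2, zero_mul, mul_zero, add_zero, le_refl]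
  have h1 := mul_le_mul_of_nonneg_left (hamgm _ _ (hf0 x hx) (hg0 x hx) hFp hGp) ha
  have h2 := mul_le_mul_of_nonneg_left (hamgm _ _ (hf0 y hy) (hg0 y hy) hFp hGp) hb
  refine (add_le_add h1 h2).trans_eq ?_
  have e1 : a * (f x / F) + b * (f y / F) = 1 := by
    rw [← mul_div_assoc, ← mul_div_assoc, ← add_div, ← hF, div_self hFp.ne']
  have e2 : a * (g x / G) + b * (g y / G) = 1 := by
    rw [← mul_div_assoc, ← mul_div_assoc, ← add_div, ← hG, div_self hGp.ne']
  set K := F ^ (1 / ((m : ℝ) + 1)) * G ^ ((m : ℝ) / ((m : ℝ) + 1))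
  linear_combination (K * (1 / ((m : ℝ) + 1))) * e1 + (K * ((m : ℝ) / ((m : ℝ) + 1))) * e2 + K * hw

/-- The ratio `R / sin^{n-1}`, one of the principal curvatures. -/
def slope (n : ℕ) (h C s : ℝ) : ℝ := R n h C s / Real.sin s ^ (n - 1)

theorem slope_eq {n : ℕ} (h C : ℝ) {s : ℝ} (hs : s ∈ Ioo 0 (Real.pi / 2)) :
    slope n h C s = h / ((n : ℝ) - 1) + C / Real.sin s ^ (n - 1) := by
  have := pow_pos (sin_pos_of_mem hs) (n - 1)
  rw [slope, R]
  field_simp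
  ring

/-! ### Slope and centre along the curve -/

namespace ProfileCurve

variable {n : ℕ} {h C : ℝ}

theorem hasDerivAt_slope (p : ProfileCurve n h C) (hn : 3 ≤ n) (φ : ℝ) :
    HasDerivAt (fun φ => slope n h C (p.X φ))
      (-(((n : ℝ) - 1) * C * Real.cos (p.X φ) / Real.sin (p.X φ) ^ n) * (p.D φ * p.μ φ)) φ := by
  obtain ⟨j, rfl⟩ : ∃ j, n = j + 3 := ⟨n - 3, by omega⟩
  have hs := sin_pos_of_mem (p.mem φ)
  have h1 := (((p.hasDerivAt_X φ).sin.pow (j + 2)).inv (pow_pos hs _).ne').const_mul C |>.const_add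
    (h / (((j + 3 : ℕ) : ℝ) - 1))
  have e : (fun φ => slope (j + 3) h C (p.X φ)) = fun φ => h / (((j + 3 : ℕ) : ℝ) - 1) +
      C * (Real.sin (p.X φ) ^ (j + 2))⁻¹ := by
    ext φ
    rw [slope_eq h C (p.mem φ), div_eq_mul_inv C]
    rfl
  rw [e]
  refine h1.congr_deriv ?_
  push_cast
  simp only [Pi.pow_apply]
  field_simp
  ring

theorem hasDerivAt_arctan_slope (p : ProfileCurve n h C) (hn : 3 ≤ n) (φ : ℝ) :
    HasDerivAt (fun φ => Real.arctan (slope n h C (p.X φ)))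
      (-(((n : ℝ) - 1) * C * Real.cos (p.X φ) / Real.sin (p.X φ) ^ n) * (p.D φ * p.μ φ) /
        (1 + slope n h C (p.X φ) ^ 2)) φ :=
  (p.hasDerivAt_slope hn φ).arctan.congr_deriv (by ring)

/-- The phase of the point where the normal geodesic of the generating curve meets the axis. -/
def centre (p : ProfileCurve n h C) (φ : ℝ) : ℝ :=
  p.Θ φ + Real.arctan (Real.sin (p.X φ) * p.D φ / R n h C (p.X φ))

/-- `D` enters only through `D² = L² - R²` and cancels. What remains is `(n - 1) R - h sin ^ (n - 1)
= (n - 1) C`, so the centre moves strictly forwards, also at the turning points. -/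
theorem hasDerivAt_centre (p : ProfileCurve n h C) (hn : 3 ≤ n) (hh : 0 < h) (hC : 0 < C) (φ : ℝ) :
    HasDerivAt p.centre (((n : ℝ) - 1) * C * Real.cos (p.X φ) * p.μ φ /
      (Real.sin (p.X φ) ^ 2 * (1 + slope n h C (p.X φ) ^ 2))) φ := by
  have hRp := R_pos hn hh hC (p.mem φ)
  have hX := p.hasDerivAt_X φ
  have h1 := (p.hasDerivAt_Θ φ).add
    (((hX.sin.mul (p.hasDerivAt_D φ)).div ((hasDerivAt_R hn h C _).comp φ hX) hRp.ne').arctan)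
  refine h1.congr_deriv ?_
  have hs := sin_pos_of_mem (p.mem φ)
  have hc := cos_pos_of_mem (p.mem φ)
  have hsc := Real.sin_sq_add_cos_sq (p.X φ)
  have hD := p.D_sq φ
  obtain ⟨j, rfl⟩ : ∃ j, n = j + 3 := ⟨n - 3, by omega⟩
  have hRC : R (j + 3) h C (p.X φ) * ((j : ℝ) + 2) =
      C * ((j : ℝ) + 2) + h * Real.sin (p.X φ) ^ j * Real.sin (p.X φ) ^ 2 := by
    rw [R, show j + 3 - 1 = j + 2 by omega]
    push_cast
    have : (j : ℝ) + 3 - 1 ≠ 0 := by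
      have : (0 : ℝ) ≤ j := j.cast_nonneg
      linarith
    field_simp
    ring
  simp only [Pi.mul_apply, Function.comp_apply, Pi.div_apply, slope, dL, dR, Nat.add_sub_cancel,
    show j + 3 - 2 = j + 1 by omega, show j + 3 - 1 = j + 2 by omega]
  have hL : L (j + 3) (p.X φ) = Real.cos (p.X φ) * Real.sin (p.X φ) ^ j * Real.sin (p.X φ) := by
    rw [L, show j + 3 - 2 = j + 1 by omega]; ring
  rw [hL] at hD ⊢
  simp only [pow_add, pow_one]
  push_cast
  have hq : 0 < Real.sin (p.X φ) ^ j := pow_pos hs j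
  set u := Real.sin (p.X φ)
  set c := Real.cos (p.X φ)
  set q := u ^ j
  set r := R (j + 3) h C (p.X φ)
  -- This gives the denominator in the derivative of the arctangent the factor `1 + slope²`, which
  -- is also the one in the target.
  have hden : r ^ 2 + (u * p.D φ) ^ 2 = c ^ 2 * (r ^ 2 + (q * u ^ 2) ^ 2) := by
    rw [mul_pow, hD]
    linear_combination (-(r ^ 2)) * hsc
  have hden' : 1 + (u * p.D φ / r) ^ 2 = c ^ 2 * (r ^ 2 + (q * u ^ 2) ^ 2) / r ^ 2 := by
    rw [← hden]; field_simp
  rw [hden']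
  have hden2 : 1 + (r / (q * u ^ 2)) ^ 2 = (r ^ 2 + (q * u ^ 2) ^ 2) / (q * u ^ 2) ^ 2 := by
    field_simp; ring
  rw [hden2]
  have hP : 0 < r ^ 2 + (q * u ^ 2) ^ 2 := by positivity
  set P := r ^ 2 + (q * u ^ 2) ^ 2 with hPdef
  have hD' : p.D φ * p.D φ = (c * q * u) ^ 2 - r ^ 2 := by rw [← sq, hD]
  field_simp
  rw [hD, hPdef]
  linear_combination (p.μ φ * c ^ 2 * u ^ 2 * q ^ 2) * hRC

end ProfileCurve

/-- A concave function of the inclination angle `τ` of the normal, with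
`supportFn n h τ * sin s = C ^ (1 / (n - 1)) * cos τ` along the curve with parameters `h`, `C`. -/
def supportFn (n : ℕ) (h τ : ℝ) : ℝ :=
  (Real.sin (τ - Real.arctan (h / ((n : ℝ) - 1))) / Real.cos (Real.arctan (h / ((n : ℝ) - 1))) *
    Real.cos τ ^ (n - 2)) ^ (1 / (((n - 2 : ℕ) : ℝ) + 1))

/-- A weighted geometric mean of the concave nonnegative functions `sin (τ - α) / cos α` and `cos
τ`, where `α = arctan (h / (n - 1))`. -/
theorem concaveOn_supportFn {n : ℕ} (hn : 3 ≤ n) {h : ℝ} (hh : 0 < h) :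
    ConcaveOn ℝ (Icc (Real.arctan (h / ((n : ℝ) - 1))) (Real.pi / 2)) (supportFn n h) := by
  have hn' : (3 : ℝ) ≤ n := by exact_mod_cast hn
  have hα : 0 < Real.arctan (h / ((n : ℝ) - 1)) :=
    Real.arctan_pos.2 (div_pos hh (by linarith))
  have hcα := Real.cos_arctan_pos (h / ((n : ℝ) - 1))
  set α := Real.arctan (h / ((n : ℝ) - 1))
  have hsub : ∀ x ∈ Icc α (Real.pi / 2), x - α ∈ Icc 0 Real.pi := fun x hx =>
    ⟨by linarith [hx.1], by linarith [hx.2, Real.pi_pos]⟩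
  refine concaveOn_rpow_mul_rpow (by omega) ⟨convex_Icc _ _, fun x hx y hy a b ha hb hab => ?_⟩
    (strictConcaveOn_cos_Icc.concaveOn.subset (Icc_subset_Icc_left (by linarith [Real.pi_pos]))
      (convex_Icc _ _)) (fun x hx => ?_) fun x hx => ?_
  · have := strictConcaveOn_sin_Icc.concaveOn.2 (hsub x hx) (hsub y hy) ha hb hab
    simp only [smul_eq_mul] at this ⊢
    rw [← mul_div_assoc, ← mul_div_assoc, ← add_div]
    gcongr
    refine this.trans_eq (congrArg Real.sin ?_)
    linear_combination (-α) * hab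
  · exact div_nonneg (Real.sin_nonneg_of_mem_Icc (hsub x hx)) hcα.le
  · exact Real.cos_nonneg_of_mem_Icc ⟨by linarith [hx.1, Real.pi_pos], hx.2⟩

theorem supportFn_pos {n : ℕ} {h τ : ℝ}
    (hτ : τ ∈ Ioo (Real.arctan (h / ((n : ℝ) - 1))) (Real.pi / 2)) : 0 < supportFn n h τ := by
  have h1 := Real.cos_arctan_pos (h / ((n : ℝ) - 1))
  have h2 := Real.neg_pi_div_two_lt_arctan (h / ((n : ℝ) - 1))
  have h3 : 0 < Real.cos τ := Real.cos_pos_of_mem_Ioo ⟨h2.trans hτ.1, hτ.2⟩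
  have h4 := Real.sin_pos_of_pos_of_lt_pi (sub_pos.2 hτ.1) (by linarith [hτ.2])
  unfold supportFn
  positivity

/-- The power `n - 1` of the support function is `(tan τ - h / (n - 1)) cos ^ (n - 1) τ`. -/
theorem supportFn_eq {n : ℕ} {h τ c : ℝ} (hn : 3 ≤ n) (hc : 0 ≤ c)
    (hτ : τ ∈ Ioo (Real.arctan (h / ((n : ℝ) - 1))) (Real.pi / 2)) :
    supportFn n h τ = c * Real.cos τ ↔ Real.tan τ = h / ((n : ℝ) - 1) + c ^ (n - 1) := by
  have h1 := Real.cos_arctan_pos (h / ((n : ℝ) - 1))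
  have h2 := Real.neg_pi_div_two_lt_arctan (h / ((n : ℝ) - 1))
  have h3 : 0 < Real.cos τ := Real.cos_pos_of_mem_Ioo ⟨h2.trans hτ.1, hτ.2⟩
  have h4 := Real.sin_pos_of_pos_of_lt_pi (sub_pos.2 hτ.1) (by linarith [hτ.2])
  have hN : (((n - 2 : ℕ) : ℝ) + 1) = ((n - 1 : ℕ) : ℝ) := by
    rw [show n - 1 = n - 2 + 1 by omega]; push_cast; rfl
  rw [supportFn, hN, one_div, Real.rpow_inv_eq (by positivity) (by positivity)
    (Nat.cast_ne_zero.2 (by omega)), Real.rpow_natCast, Real.sin_sub, sub_div, mul_div_assoc,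
    mul_div_assoc, div_self h1.ne', ← Real.tan_eq_sin_div_cos, Real.tan_arctan,
    Real.tan_eq_sin_div_cos, show n - 1 = n - 2 + 1 by omega]
  rw [mul_pow, pow_succ (Real.cos τ), mul_comm (Real.cos τ ^ (n - 2)), ← mul_assoc,
    mul_left_inj' (pow_pos h3 (n - 2)).ne', div_eq_iff h3.ne']
  constructor <;> intro h <;> linarith

/-- The inclination angle of the normal at latitude `s`. -/
def inclination (n : ℕ) (h C s : ℝ) : ℝ := Real.arctan (slope n h C s)

theorem inclination_mem {n : ℕ} {h C s : ℝ} (hC : 0 < C)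
    (hs : s ∈ Ioo 0 (Real.pi / 2)) :
    inclination n h C s ∈ Ioo (Real.arctan (h / ((n : ℝ) - 1))) (Real.pi / 2) := by
  refine ⟨Real.arctan_strictMono ?_, Real.arctan_lt_pi_div_two _⟩
  rw [slope_eq h C hs]
  have := div_pos hC (pow_pos (sin_pos_of_mem hs) (n - 1))
  linarith

theorem rpow_inv_pow {n : ℕ} (hn : 3 ≤ n) {C : ℝ} (hC : 0 < C) :
    (C ^ (1 / ((n : ℝ) - 1))) ^ (n - 1) = C := by
  have hN : ((n : ℝ) - 1) = ((n - 1 : ℕ) : ℝ) := by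
    rw [Nat.cast_sub (by omega)]; simp
  rw [hN, one_div, Real.rpow_inv_natCast_pow hC.le (by omega)]

theorem supportFn_inclination {n : ℕ} (hn : 3 ≤ n) {h C s : ℝ} (hC : 0 < C)
    (hs : s ∈ Ioo 0 (Real.pi / 2)) :
    supportFn n h (inclination n h C s) =
      C ^ (1 / ((n : ℝ) - 1)) / Real.sin s * Real.cos (inclination n h C s) := by
  have h0 := sin_pos_of_mem hs
  rw [supportFn_eq hn (by positivity) (inclination_mem hC hs), inclination, Real.tan_arctan,
    slope_eq h C hs, div_pow, rpow_inv_pow hn hC]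

theorem cos_inclination_pos (n : ℕ) (h C s : ℝ) : 0 < Real.cos (inclination n h C s) :=
  Real.cos_arctan_pos _

/-- With `R = k sin ^ (n - 1)` and `cos² τ = 1 / (1 + k²)` this is `cos² - k² sin² = 1 - (1 + k²)
sin²`. By `supportFn_inclination` the quotient on the right is `c / S(τ)`. -/
theorem L_sq_sub_R_sq {n : ℕ} (hn : 3 ≤ n) {h C s : ℝ} (hs : s ∈ Ioo 0 (Real.pi / 2)) :
    L n s ^ 2 - R n h C s ^ 2 =
      (Real.sin s ^ (n - 2)) ^ 2 * (1 - (Real.sin s / Real.cos (inclination n h C s)) ^ 2) := by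
  have h0 := sin_pos_of_mem hs
  have h1 : R n h C s = slope n h C s * (Real.sin s ^ (n - 2) * Real.sin s) := by
    rw [slope, ← pow_succ, show n - 2 + 1 = n - 1 by omega]
    field_simp
  rw [div_pow, inclination, Real.cos_sq_arctan, h1, L]
  have := Real.sin_sq_add_cos_sq s
  field_simp
  linear_combination this

/-! ### The chord comparison -/

namespace ProfileCurve

variable {n : ℕ} {h C : ℝ}

theorem Θ_right (p : ProfileCurve n h C) : p.Θ (Real.pi / 2) = W n h C / 2 := by
  have := p.Θ_symm (Real.pi / 2)
  rw [sub_half] at this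
  linarith

theorem Θ_left (p : ProfileCurve n h C) : p.Θ (-(Real.pi / 2)) = 0 := by
  have h1 := p.Θ_symm (-(Real.pi / 2))
  have h2 := p.Θ_add_two_pi (-(Real.pi / 2))
  rw [show -(Real.pi / 2) + 2 * Real.pi = Real.pi - -(Real.pi / 2) by ring] at h2
  linarith

theorem supportFn_eq_of_D_eq_zero (p : ProfileCurve n h C) (hn : 3 ≤ n) (hC : 0 < C) {φ : ℝ}
    (hD : p.D φ = 0) :
    supportFn n h (inclination n h C (p.X φ)) = C ^ (1 / ((n : ℝ) - 1)) := by
  have h1 := p.D_sq φ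
  have h0 := sin_pos_of_mem (p.mem φ)
  have h2 := cos_inclination_pos n h C (p.X φ)
  rw [L_sq_sub_R_sq hn (p.mem φ), hD] at h1
  have h3 : (Real.sin (p.X φ) / Real.cos (inclination n h C (p.X φ))) ^ 2 = 1 := by
    have h4 : (Real.sin (p.X φ) ^ (n - 2)) ^ 2 ≠ 0 := by positivity
    have h5 : 1 - (Real.sin (p.X φ) / Real.cos (inclination n h C (p.X φ))) ^ 2 = 0 := by
      refine (mul_eq_zero.1 ?_).resolve_left h4
      rw [← h1]; ring
    linarith
  have h6 : Real.sin (p.X φ) / Real.cos (inclination n h C (p.X φ)) = 1 := by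
    have : 0 < Real.sin (p.X φ) / Real.cos (inclination n h C (p.X φ)) := by positivity
    nlinarith
  rw [supportFn_inclination hn hC (p.mem φ), div_mul_comm, ← inv_div, h6]
  simp

theorem exists_inclination_eq (p : ProfileCurve n h C) (hn : 3 ≤ n) (hC : 0 < C)
    {t : ℝ} (ht : t ∈ Ioo (Real.arctan (h / ((n : ℝ) - 1))) (Real.pi / 2))
    (hct : C ^ (1 / ((n : ℝ) - 1)) < supportFn n h t) :
    ∃ φ ∈ Ioo (-(Real.pi / 2)) (Real.pi / 2), inclination n h C (p.X φ) = t := by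
  have hZ := supportFn_pos ht
  have hc : 0 < C ^ (1 / ((n : ℝ) - 1)) := by positivity
  have h2 := Real.neg_pi_div_two_lt_arctan (h / ((n : ℝ) - 1))
  have hcos : 0 < Real.cos t := Real.cos_pos_of_mem_Ioo ⟨h2.trans ht.1, ht.2⟩
  set c := C ^ (1 / ((n : ℝ) - 1)) with hcdef
  set Z := supportFn n h t with hZdef
  -- The sine of the latitude sought, solved from `S(t) sin s = c cos t`. The assumption `c < S(t)`
  -- becomes `u < cos t`, which places this latitude in `J`.
  set u := c * Real.cos t / Z with hu
  have hu0 : 0 < u := by positivity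
  have hu1 : u < Real.cos t := by
    rw [hu, div_lt_iff₀ hZ]
    nlinarith
  have hu2 := hu1.trans_le (Real.cos_le_one t)
  have hsin : Real.sin (Real.arcsin u) = u := Real.sin_arcsin (by linarith) hu2.le
  have hs : Real.arcsin u ∈ Ioo 0 (Real.pi / 2) :=
    ⟨Real.arcsin_pos.2 hu0, Real.arcsin_lt_pi_div_two.2 hu2⟩
  have hincl : inclination n h C (Real.arcsin u) = t := by
    have h1 := (supportFn_eq hn (c := c / u) (by positivity) ht).1 (by rw [← hZdef, hu]; field_simp)
    rw [inclination, slope_eq h C hs, hsin, ← rpow_inv_pow hn hC, ← hcdef, ← div_pow, ← h1,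
      Real.arctan_tan (h2.trans ht.1) ht.2]
  have hJ : Real.arcsin u ∈ J n h C := by
    refine ⟨hs, ?_⟩
    have h3 := L_sq_sub_R_sq hn (h := h) (C := C) hs
    rw [hincl, hsin] at h3
    have h4 : (u / Real.cos t) ^ 2 < 1 := by
      have : u / Real.cos t < 1 := (div_lt_one hcos).2 hu1
      have : 0 < u / Real.cos t := by positivity
      nlinarith
    have h5 : 0 < (u ^ (n - 2)) ^ 2 * (1 - (u / Real.cos t) ^ 2) :=
      mul_pos (by positivity) (by linarith)
    exact abs_lt_of_sq_lt_sq (by linarith) (L_pos n hs).le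
  rw [p.J_eq] at hJ
  obtain ⟨φ, hφ, hφ2⟩ := hJ
  exact ⟨φ, hφ, by rw [hφ2, hincl]⟩

/-- The half period is the displacement of `centre` from `-π/2` to `π/2`. It is split where the
inclination equals `t`, and on each piece `supportFn` is bounded below by the chord from the end
value `c` to `Z`. -/
theorem W_le (p : ProfileCurve n h C) (hn : 3 ≤ n) (hh : 0 < h) (hC : 0 < C)
    {t : ℝ} (ht : t ∈ Ioo (Real.arctan (h / ((n : ℝ) - 1))) (Real.pi / 2))
    (hct : C ^ (1 / ((n : ℝ) - 1)) < supportFn n h t) :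
    W n h C / 2 ≤ (Real.pi / 2 - Real.arctan (h / ((n : ℝ) - 1))) *
      (√(supportFn n h t ^ 2 - (C ^ (1 / ((n : ℝ) - 1))) ^ 2) /
        (supportFn n h t - C ^ (1 / ((n : ℝ) - 1)))) := by
  obtain ⟨x, hx, hxt⟩ := p.exists_inclination_eq hn hC ht hct
  have hn' : (3 : ℝ) ≤ n := by exact_mod_cast hn
  have hc : 0 < C ^ (1 / ((n : ℝ) - 1)) := by positivity
  have hconc := concaveOn_supportFn hn hh
  set c := C ^ (1 / ((n : ℝ) - 1)) with hcdef
  set Z := supportFn n h t with hZdef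
  set α := Real.arctan (h / ((n : ℝ) - 1))
  set τ : ℝ → ℝ := fun φ => inclination n h C (p.X φ) with hτdef
  set τ' : ℝ → ℝ := fun φ => (-(((n : ℝ) - 1) * C * Real.cos (p.X φ) / Real.sin (p.X φ) ^ n) *
    (p.D φ * p.μ φ) / (1 + slope n h C (p.X φ) ^ 2)) with hτ'def
  have hτ : ∀ φ, HasDerivAt τ (τ' φ) φ := fun φ => p.hasDerivAt_arctan_slope hn φ
  set χ' : ℝ → ℝ := fun φ => (((n : ℝ) - 1) * C * Real.cos (p.X φ) * p.μ φ /
      (Real.sin (p.X φ) ^ 2 * (1 + slope n h C (p.X φ) ^ 2))) with hχ'def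
  have hχ : ∀ φ, HasDerivAt p.centre (χ' φ) φ := fun φ => p.hasDerivAt_centre hn hh hC φ
  set r : ℝ → ℝ := fun φ => p.D φ / Real.sin (p.X φ) ^ (n - 2) with hrdef
  have hn1 : 0 < (n : ℝ) - 1 := by linarith
  have hχ'pos : ∀ φ, 0 < χ' φ := fun φ => by
    have h1 := sin_pos_of_mem (p.mem φ)
    have h2 := cos_pos_of_mem (p.mem φ)
    have h3 := p.μ_pos φ
    positivity
  have hrpos : ∀ φ ∈ Ioo (-(Real.pi / 2)) (Real.pi / 2), 0 < r φ := fun φ hφ =>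
    div_pos (p.D_pos φ hφ) (pow_pos (sin_pos_of_mem (p.mem φ)) _)
  -- So `dχ/dτ = -1 / r`, and `hr2` says `r² = 1 - c² / S²`.
  have hrχ : ∀ φ, χ' φ * r φ = -τ' φ := fun φ => by
    have h1 := sin_pos_of_mem (p.mem φ)
    have h2 : Real.sin (p.X φ) ^ n = Real.sin (p.X φ) ^ (n - 2) * Real.sin (p.X φ) ^ 2 := by
      rw [← pow_add, show n - 2 + 2 = n by omega]
    simp only [hχ'def, hrdef, hτ'def, h2]
    field_simp
  have hr2 : ∀ φ, r φ ^ 2 * supportFn n h (τ φ) ^ 2 = supportFn n h (τ φ) ^ 2 - c ^ 2 := fun φ => by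
    have h1 := sin_pos_of_mem (p.mem φ)
    have h2 := cos_inclination_pos n h C (p.X φ)
    simp only [hrdef, hτdef, div_pow, p.D_sq, L_sq_sub_R_sq hn (p.mem φ),
      supportFn_inclination hn hC (p.mem φ), ← hcdef]
    field_simp
  have hanti : StrictAntiOn τ (Icc (-(Real.pi / 2)) (Real.pi / 2)) := by
    refine strictAntiOn_of_deriv_neg (convex_Icc _ _)
      (fun φ _ => (hτ φ).continuousAt.continuousWithinAt) fun φ hφ => ?_
    rw [interior_Icc] at hφ
    rw [(hτ φ).deriv]
    have := mul_pos (hχ'pos φ) (hrpos φ hφ)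
    rw [hrχ] at this
    linarith
  have hmem : ∀ φ, τ φ ∈ Ioo α (Real.pi / 2) := fun φ => inclination_mem hC (p.mem φ)
  have hpi := Real.pi_pos
  have hl : (-(Real.pi / 2)) ∈ Icc (-(Real.pi / 2)) (Real.pi / 2) := left_mem_Icc.2 (by linarith)
  have hr : (Real.pi / 2) ∈ Icc (-(Real.pi / 2)) (Real.pi / 2) := right_mem_Icc.2 (by linarith)
  have hx' := Ioo_subset_Icc_self hx
  have hτl : supportFn n h (τ (-(Real.pi / 2))) = c := p.supportFn_eq_of_D_eq_zero hn hC p.D_left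
  have hτr : supportFn n h (τ (Real.pi / 2)) = c := p.supportFn_eq_of_D_eq_zero hn hC p.D_right
  have hchord : ∀ e ∈ Icc α (Real.pi / 2), supportFn n h e = c → ∀ v ∈ Icc (0 : ℝ) 1,
      c + v * (Z - c) ≤ supportFn n h (e + v * (t - e)) := by
    intro e he hec v hv
    have := hconc.2 he (Ioo_subset_Icc_self ht) (sub_nonneg.2 hv.2) hv.1 (by ring)
    rw [hec, ← hZdef] at this
    simp only [smul_eq_mul] at this
    calc c + v * (Z - c) = (1 - v) * c + v * Z := by ring
      _ ≤ _ := this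
      _ = _ := congrArg _ (by ring)
  have hrc : ∀ φ z, 0 ≤ z → c + z ≤ supportFn n h (τ φ) →
      (c + z) ^ 2 - c ^ 2 ≤ r φ ^ 2 * (c + z) ^ 2 := by
    intro φ z hz hle
    have h1 := hr2 φ
    have h2 : (c + z) ^ 2 ≤ supportFn n h (τ φ) ^ 2 := by gcongr
    have h3 : r φ ^ 2 ≤ 1 := by
      have : 0 < supportFn n h (τ φ) ^ 2 := by nlinarith
      by_contra hcon
      nlinarith [sq_nonneg c]
    nlinarith
  -- `τ` decreases along the curve; measured from its value at the right end it is positive there,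
  -- and `ε = -1`. For `hleft` it is measured downwards from the left end, with `ε = 1`.
  have hright : p.centre (Real.pi / 2) - p.centre x ≤
      (t - τ (Real.pi / 2)) * (√(Z ^ 2 - c ^ 2) / (Z - c)) := by
    have hd : 0 < t - τ (Real.pi / 2) := by
      rw [← hxt]; exact sub_pos.2 (hanti hx' hr hx.2)
    have := sub_le_of_affine_comparison (χ := p.centre) (τ := fun φ => τ φ - τ (Real.pi / 2))
      (τ' := τ') (r := r) (c := c) (l := (Z - c) / (t - τ (Real.pi / 2))) (ε := -1) hx.2.le hc
      (div_pos (sub_pos.2 hct) hd) hχ (fun φ => (hτ φ).sub_const _)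
      (fun φ hφ => sub_pos.2 (hanti ⟨hx'.1.trans hφ.1.le, hφ.2.le⟩ hr hφ.2))
      (fun φ _ => (hχ'pos φ).le) (fun φ hφ => (hrpos φ ⟨hx.1.trans hφ.1, hφ.2⟩).le)
      (fun φ _ => by rw [hrχ]; ring) ?_
    · refine this.trans_eq ?_
      simp only [sub_self, mul_zero, add_zero, Real.sqrt_zero]
      rw [show τ x = t from hxt, div_mul_cancel₀ _ hd.ne', add_sub_cancel]
      field_simp
      ring
    · intro φ hφ
      have h1 : 0 < τ φ - τ (Real.pi / 2) :=
        sub_pos.2 (hanti ⟨hx'.1.trans hφ.1.le, hφ.2.le⟩ hr hφ.2)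
      have h2 : τ φ < t := by
        rw [← hxt]; exact hanti hx' ⟨hx'.1.trans hφ.1.le, hφ.2.le⟩ hφ.1
      refine hrc φ _ (mul_nonneg (div_pos (sub_pos.2 hct) hd).le h1.le) ?_
      have := hchord _ (Ioo_subset_Icc_self (hmem _)) hτr
        ((τ φ - τ (Real.pi / 2)) / (t - τ (Real.pi / 2)))
        ⟨by positivity, (div_le_one hd).2 (by linarith)⟩
      rw [div_mul_cancel₀ _ hd.ne', add_sub_cancel] at this
      refine le_trans (le_of_eq ?_) this
      ring
  have hleft : p.centre x - p.centre (-(Real.pi / 2)) ≤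
      (τ (-(Real.pi / 2)) - t) * (√(Z ^ 2 - c ^ 2) / (Z - c)) := by
    have hd : 0 < τ (-(Real.pi / 2)) - t := by
      rw [← hxt]; exact sub_pos.2 (hanti hl hx' hx.1)
    have := sub_le_of_affine_comparison (χ := p.centre) (τ := fun φ => τ (-(Real.pi / 2)) - τ φ)
      (τ' := fun φ => -τ' φ) (r := r) (c := c) (l := (Z - c) / (τ (-(Real.pi / 2)) - t)) (ε := 1)
      hx.1.le hc (div_pos (sub_pos.2 hct) hd) hχ (fun φ => (hτ φ).const_sub _)
      (fun φ hφ => sub_pos.2 (hanti hl ⟨hφ.1.le, hφ.2.le.trans hx'.2⟩ hφ.1))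
      (fun φ _ => (hχ'pos φ).le) (fun φ hφ => (hrpos φ ⟨hφ.1, hφ.2.trans hx.2⟩).le)
      (fun φ _ => by rw [hrχ]; ring) ?_
    · refine this.trans_eq ?_
      simp only [sub_self, mul_zero, add_zero, Real.sqrt_zero]
      rw [show τ x = t from hxt, div_mul_cancel₀ _ hd.ne', add_sub_cancel]
      field_simp
      ring
    · intro φ hφ
      have h1 : 0 < τ (-(Real.pi / 2)) - τ φ :=
        sub_pos.2 (hanti hl ⟨hφ.1.le, hφ.2.le.trans hx'.2⟩ hφ.1)
      have h2 : t < τ φ := by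
        rw [← hxt]; exact hanti ⟨hφ.1.le, hφ.2.le.trans hx'.2⟩ hx' hφ.2
      refine hrc φ _ (mul_nonneg (div_pos (sub_pos.2 hct) hd).le h1.le) ?_
      have := hchord _ (Ioo_subset_Icc_self (hmem _)) hτl
        ((τ (-(Real.pi / 2)) - τ φ) / (τ (-(Real.pi / 2)) - t))
        ⟨by positivity, (div_le_one hd).2 (by linarith)⟩
      have e : τ (-(Real.pi / 2)) + (τ (-(Real.pi / 2)) - τ φ) / (τ (-(Real.pi / 2)) - t) *
          (t - τ (-(Real.pi / 2))) = τ φ := by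
        field_simp
        ring
      rw [e] at this
      refine le_trans (le_of_eq ?_) this
      ring
  -- `D` vanishes at both ends, so the centre has the same phase as the curve there.
  have hcl : p.centre (-(Real.pi / 2)) = 0 := by simp [centre, p.Θ_left, p.D_left]
  have hcr : p.centre (Real.pi / 2) = W n h C / 2 := by simp [centre, p.Θ_right, p.D_right]
  rw [← hcr]
  have hQ : 0 ≤ √(Z ^ 2 - c ^ 2) / (Z - c) := div_nonneg (Real.sqrt_nonneg _) (by linarith)
  have h1 := (hmem (-(Real.pi / 2))).2
  have h2 := (hmem (Real.pi / 2)).1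
  nlinarith

end ProfileCurve

/-! ### A period of length `π` -/

theorem exists_W_lt_pi {n : ℕ} (hn : 3 ≤ n) {h : ℝ} (hh : 0 < h) :
    ∃ C ∈ Ioo 0 (Cmax n h), W n h C < Real.pi := by
  obtain ⟨ς, H⟩ := exists_isGapCoordinate hn hh
  have hn' : (3 : ℝ) ≤ n := by exact_mod_cast hn
  have hα : 0 < Real.arctan (h / ((n : ℝ) - 1)) := Real.arctan_pos.2 (div_pos hh (by linarith))
  -- Any inclination will do: with `t` fixed, the quotient in `W_le` tends to `1` as `C → 0`.
  obtain ⟨t, ht⟩ : (Ioo (Real.arctan (h / ((n : ℝ) - 1))) (Real.pi / 2)).Nonempty :=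
    nonempty_Ioo.2 (Real.arctan_lt_pi_div_two _)
  have hZ := supportFn_pos ht
  set Z := supportFn n h t with hZdef
  set α := Real.arctan (h / ((n : ℝ) - 1)) with hαdef
  have hp : 0 < 1 / ((n : ℝ) - 1) := div_pos one_pos (by linarith)
  have hc : Filter.Tendsto (fun C : ℝ => C ^ (1 / ((n : ℝ) - 1))) (nhdsWithin 0 (Ioi 0))
      (nhds 0) := by
    have := (Real.continuousAt_rpow_const 0 (1 / ((n : ℝ) - 1)) (Or.inr hp.le)).tendsto
    rw [Real.zero_rpow hp.ne'] at this
    exact this.mono_left nhdsWithin_le_nhds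
  have hbound : Filter.Tendsto
      (fun c : ℝ => (Real.pi / 2 - α) * (√(Z ^ 2 - c ^ 2) / (Z - c))) (nhds 0)
      (nhds (Real.pi / 2 - α)) := by
    have h1 : ContinuousAt (fun c : ℝ => (Real.pi / 2 - α) * (√(Z ^ 2 - c ^ 2) / (Z - c))) 0 := by
      refine continuousAt_const.mul (ContinuousAt.div (by fun_prop) (by fun_prop) ?_)
      simpa using hZ.ne'
    have h2 := h1.tendsto
    simpa [Real.sqrt_sq hZ.le, hZ.ne'] using h2
  have e1 := (hbound.comp hc).eventually
    (gt_mem_nhds (show Real.pi / 2 - α < Real.pi / 2 by linarith))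
  have e2 := hc.eventually (gt_mem_nhds hZ)
  have e3 : ∀ᶠ C in nhdsWithin (0 : ℝ) (Ioi 0), C ∈ Ioo 0 (Cmax n h) :=
    Ioo_mem_nhdsGT (Cmax_pos hn hh)
  obtain ⟨C, h1, h2, h3⟩ := (e1.and (e2.and e3)).exists
  refine ⟨C, h3, ?_⟩
  have := (H.profileCurve h3).W_le hn hh h3.1 ht h2
  simp only [Function.comp_apply] at h1
  linarith

theorem exists_W_eq_pi {n : ℕ} (hn : 3 ≤ n) {h : ℝ} (hh : 0 < h)
    (hh2 : h ^ 2 < 4 * ((n : ℝ) - 2) / 3) :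
    ∃ C ∈ Ioo 0 (Cmax n h), W n h C = Real.pi := by
  obtain ⟨ς, H⟩ := exists_isGapCoordinate hn hh
  obtain ⟨C₀, hC₀, hW⟩ := exists_W_lt_pi hn hh
  rw [H.W_eq hC₀] at hW
  have hcont := H.continuousOn_integral_angularSpeed.mono
    (show Icc C₀ (Cmax n h) ⊆ Ioc 0 (Cmax n h) from fun x hx => ⟨hC₀.1.trans_le hx.1, hx.2⟩)
  obtain ⟨C, hC, hCW⟩ := intermediate_value_Ioo hC₀.2.le hcont
    (show Real.pi / 2 ∈ _ from ⟨by linarith, H.integral_angularSpeed_Cmax hh2⟩)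
  have hC' : C ∈ Ioo 0 (Cmax n h) := ⟨hC₀.1.trans hC.1, hC.2⟩
  refine ⟨C, hC', ?_⟩
  rw [H.W_eq hC']
  simp only at hCW
  linarith

/-! ### Maps on the circle -/

section Circle

variable {F : Type*} [NormedAddCommGroup F] [NormedSpace ℝ F]

attribute [local instance] finrank_real_complex_fact'

theorem contMDiff_circle_coe : ContMDiff (𝓡 1) 𝓘(ℝ, ℂ) ∞ fun z : Circle => (z : ℂ) :=
  contMDiff_coe_sphere (E := ℂ) (n := 1)

theorem contMDiff_of_comp_circleExp {f : Circle → F}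
    (hf : ContDiff ℝ ∞ fun t : ℝ => f (Circle.exp t)) : ContMDiff (𝓡 1) 𝓘(ℝ, F) ∞ f := by
  intro z₀
  obtain ⟨t₀, rfl⟩ := Circle.exp_surjective z₀
  -- Every branch of the angle gives this identity on the whole circle; centring the logarithm at
  -- `t₀` makes it smooth near the given point.
  have key : f = (fun t : ℝ => f (Circle.exp t)) ∘
      (fun w : ℂ => t₀ + (Complex.log (w * (Circle.exp (-t₀) : ℂ))).im) ∘
        fun z : Circle => (z : ℂ) := by
    ext z
    simp only [Function.comp_apply]
    rw [Complex.log_im, ← Circle.coe_mul, Circle.exp_add, Circle.exp_arg, Circle.exp_neg,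
      mul_comm z, mul_inv_cancel_left]
  rw [key]
  refine hf.contMDiff.contMDiffAt.comp _ (ContMDiffAt.comp (I' := 𝓘(ℝ, ℂ)) _ ?_
    contMDiff_circle_coe.contMDiffAt)
  refine ContDiffAt.contMDiffAt (contDiffAt_const.add ?_)
  have h1 : ContDiffAt ℝ ∞ (fun w : ℂ => w * (Circle.exp (-t₀) : ℂ)) (Circle.exp t₀ : ℂ) := by
    fun_prop
  have h2 : ContDiffAt ℝ ∞ Complex.log ((Circle.exp t₀ : ℂ) * (Circle.exp (-t₀) : ℂ)) := by
    refine (Complex.contDiffAt_log ?_).restrict_scalars ℝ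
    rw [← Circle.coe_mul, ← Circle.exp_add, add_neg_cancel, Circle.exp_zero]
    exact Complex.one_mem_slitPlane
  exact Complex.imCLM.contDiff.contDiffAt.comp _
    (ContDiffAt.comp (g := Complex.log) (f := fun w : ℂ => w * (Circle.exp (-t₀) : ℂ))
      (Circle.exp t₀ : ℂ) h2 h1)

/-- The velocity of the standard parametrization of the circle. -/
def circleVelocity (t : ℝ) : TangentSpace (𝓡 1) (Circle.exp t) :=
  mfderiv 𝓘(ℝ, ℝ) (𝓡 1) Circle.exp t (1 : ℝ)

theorem mvfderiv_circleVelocity {f : Circle → F} {t : ℝ} {f' : F}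
    (hf : MDifferentiableAt (𝓡 1) 𝓘(ℝ, F) f (Circle.exp t))
    (hf' : HasDerivAt (fun t : ℝ => f (Circle.exp t)) f' t) :
    mvfderiv (𝓡 1) f (Circle.exp t) (circleVelocity t) = f' := by
  have h1 := hf.hasMFDerivAt.comp t
    ((contMDiff_circleExp (m := ∞)).mdifferentiable (by simp) t).hasMFDerivAt
  have h2 := hf'.hasFDerivAt.hasMFDerivAt
  have h3 := hasMFDerivAt_unique h1 h2
  exact (congrArg (fun A : ℝ →L[ℝ] F => A 1) h3).trans (by simp)

theorem exists_eq_smul_circleVelocity (t : ℝ) (v : TangentSpace (𝓡 1) (Circle.exp t)) :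
    ∃ c : ℝ, v = c • circleVelocity t := by
  have h0 : circleVelocity t ≠ 0 := by
    intro h
    have h1 : HasDerivAt (fun t : ℝ => ((Circle.exp t : Circle) : ℂ))
        (Complex.exp (t * Complex.I) * Complex.I) t := by
      simp only [Circle.coe_exp]
      have := (((hasDerivAt_id (t : ℂ)).mul_const Complex.I).cexp).comp_ofReal
      simpa using this
    have h2 := mvfderiv_circleVelocity
      (contMDiff_circle_coe.mdifferentiable (by decide) _) h1
    rw [h, map_zero] at h2
    exact mul_ne_zero (Complex.exp_ne_zero _) Complex.I_ne_zero h2.symm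
  have h1 : Module.finrank ℝ (TangentSpace (𝓡 1) (Circle.exp t)) = 1 :=
    finrank_euclideanSpace_fin (𝕜 := ℝ) (n := 1)
  obtain ⟨c, hc⟩ := exists_smul_eq_of_finrank_eq_one h1 h0 v
  exact ⟨c, hc.symm⟩

end Circle

/-! ### Spiral products -/

section Spiral

variable {n : ℕ}

theorem contMDiff_orbit_coe : ContMDiff (𝓡 (n - 2))
    𝓘(ℝ, EuclideanSpace ℝ (Fin (n - 2 + 1))) ∞
    ((↑) : Orbit n → EuclideanSpace ℝ (Fin (n - 2 + 1))) :=
  have := Fact.mk (finrank_euclideanSpace_fin (𝕜 := ℝ) (n := n - 2 + 1))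
  contMDiff_coe_sphere (E := EuclideanSpace ℝ (Fin (n - 2 + 1))) (n := n - 2)

theorem injective_mvfderiv_orbit_coe (x : Orbit n) : Function.Injective (mvfderiv (𝓡 (n - 2))
    ((↑) : Orbit n → EuclideanSpace ℝ (Fin (n - 2 + 1))) x) :=
  have := Fact.mk (finrank_euclideanSpace_fin (𝕜 := ℝ) (n := n - 2 + 1))
  injective_mvfderiv_subtypeVal_sphere x

theorem inner_mvfderiv_orbit_coe (x : Orbit n) (v : TangentSpace (𝓡 (n - 2)) x) :
    ⟪(x : EuclideanSpace ℝ (Fin (n - 2 + 1))), mvfderiv (𝓡 (n - 2))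
      ((↑) : Orbit n → EuclideanSpace ℝ (Fin (n - 2 + 1))) x v⟫_ℝ = 0 := by
  have := Fact.mk (finrank_euclideanSpace_fin (𝕜 := ℝ) (n := n - 2 + 1))
  have h := range_mvfderiv_subtypeVal (n := n - 2) x
  exact Submodule.mem_orthogonal_singleton_iff_inner_right.1 (h ▸ LinearMap.mem_range_self _ v)

/-- The bilinear map underlying `spiralProduct`. -/
def spiralMap (n : ℕ) (a : WithLp 2 (ℂ × ℝ) × EuclideanSpace ℝ (Fin (n - 2 + 1))) : Ambient n :=
  WithLp.toLp 2 (a.1.fst, a.1.snd • a.2)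

theorem contDiff_spiralMap : ContDiff ℝ ∞ (spiralMap n) := by
  have h1 : ContDiff ℝ ∞ fun a : WithLp 2 (ℂ × ℝ) × EuclideanSpace ℝ (Fin (n - 2 + 1)) =>
      (a.1.fst, a.1.snd • a.2) := by
    have hf : ContDiff ℝ ∞ fun a : WithLp 2 (ℂ × ℝ) => a.fst :=
      (WithLp.fstL 2 ℝ ℂ ℝ).contDiff
    have hs : ContDiff ℝ ∞ fun a : WithLp 2 (ℂ × ℝ) => a.snd :=
      (WithLp.sndL 2 ℝ ℂ ℝ).contDiff
    exact (hf.comp contDiff_fst).prodMk ((hs.comp contDiff_fst).smul contDiff_snd)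
  exact (WithLp.prodContinuousLinearEquiv 2 ℝ ℂ
    (EuclideanSpace ℝ (Fin (n - 2 + 1)))).symm.contDiff.comp h1

theorem fderiv_spiralMap (a b : WithLp 2 (ℂ × ℝ) × EuclideanSpace ℝ (Fin (n - 2 + 1))) :
    fderiv ℝ (spiralMap n) a b =
      WithLp.toLp 2 (b.1.fst, b.1.snd • a.2 + a.1.snd • b.2) := by
  have h1 : HasFDerivAt (fun a : WithLp 2 (ℂ × ℝ) × EuclideanSpace ℝ (Fin (n - 2 + 1)) => a.1.fst)
      ((WithLp.fstL 2 ℝ ℂ ℝ).comp (ContinuousLinearMap.fst ℝ _ _)) a :=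
    (WithLp.fstL 2 ℝ ℂ ℝ).hasFDerivAt.comp a hasFDerivAt_fst
  have h2 : HasFDerivAt (fun a : WithLp 2 (ℂ × ℝ) × EuclideanSpace ℝ (Fin (n - 2 + 1)) => a.1.snd)
      ((WithLp.sndL 2 ℝ ℂ ℝ).comp (ContinuousLinearMap.fst ℝ _ _)) a :=
    (WithLp.sndL 2 ℝ ℂ ℝ).hasFDerivAt.comp a hasFDerivAt_fst
  have h3 := (WithLp.prodContinuousLinearEquiv 2 ℝ ℂ
    (EuclideanSpace ℝ (Fin (n - 2 + 1)))).symm.hasFDerivAt.comp a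
      (h1.prodMk (h2.smul hasFDerivAt_snd))
  have h4 : fderiv ℝ (spiralMap n) a = _ := h3.fderiv
  rw [h4]
  simp [add_comm]

theorem contMDiff_spiralProduct {σ : Circle → WithLp 2 (ℂ × ℝ)}
    (hσ : ContMDiff (𝓡 1) 𝓘(ℝ, WithLp 2 (ℂ × ℝ)) ∞ σ) :
    ContMDiff ((𝓡 1).prod (𝓡 (n - 2))) 𝓘(ℝ, Ambient n) ∞ (spiralProduct n σ) :=
  contDiff_spiralMap.contMDiff.comp
    ((hσ.comp contMDiff_fst).prodMk_space
      ((contMDiff_orbit_coe (n := n)).comp contMDiff_snd))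

theorem mvfderiv_spiralProduct {σ : Circle → WithLp 2 (ℂ × ℝ)}
    (hσ : ContMDiff (𝓡 1) 𝓘(ℝ, WithLp 2 (ℂ × ℝ)) ∞ σ) (q : Circle × Orbit n)
    (v : TangentSpace ((𝓡 1).prod (𝓡 (n - 2))) q) :
    mvfderiv ((𝓡 1).prod (𝓡 (n - 2))) (spiralProduct n σ) q v =
      WithLp.toLp 2 ((mvfderiv (𝓡 1) σ q.1 v.1).fst,
        (mvfderiv (𝓡 1) σ q.1 v.1).snd • (q.2 : EuclideanSpace ℝ (Fin (n - 2 + 1))) +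
          (σ q.1).snd • mvfderiv (𝓡 (n - 2))
            ((↑) : Orbit n → EuclideanSpace ℝ (Fin (n - 2 + 1))) q.2 v.2) := by
  have h1 := (hσ.mdifferentiable (by simp) q.1).hasMFDerivAt.comp q
    (hasMFDerivAt_fst (I := 𝓡 1) (I' := 𝓡 (n - 2)) q)
  have h2 := (contMDiff_orbit_coe.mdifferentiable (by simp) q.2).hasMFDerivAt.comp q
    (hasMFDerivAt_snd (I := 𝓡 1) (I' := 𝓡 (n - 2)) q)
  have h3 : HasMFDerivAt ((𝓡 1).prod (𝓡 (n - 2)))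
      𝓘(ℝ, WithLp 2 (ℂ × ℝ) × EuclideanSpace ℝ (Fin (n - 2 + 1)))
      (fun q : Circle × Orbit n => (σ q.1, (q.2 : EuclideanSpace ℝ (Fin (n - 2 + 1))))) q
      (ContinuousLinearMap.prod _ _) :=
    ⟨h1.1.prodMk h2.1, h1.2.prodMk h2.2⟩
  have h4 := (contDiff_spiralMap (n := n)).differentiable (by simp)
    (σ q.1, (q.2 : EuclideanSpace ℝ (Fin (n - 2 + 1)))) |>.hasFDerivAt.hasMFDerivAt
  have h5 := (h4.comp q h3).mfderiv
  exact (congrArg (fun A => A v) h5).trans (fderiv_spiralMap _ _)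

/-- As `‖x‖ = 1`, the unit and orthogonality relations between values reduce to those of curves in
`ℂ ⊕ ℝ`. -/
theorem inner_spiralProduct (σ τ : Circle → WithLp 2 (ℂ × ℝ)) (q : Circle × Orbit n) :
    ⟪spiralProduct n σ q, spiralProduct n τ q⟫_ℝ = ⟪σ q.1, τ q.1⟫_ℝ := by
  have h : ‖(q.2 : EuclideanSpace ℝ (Fin (n - 2 + 1)))‖ = 1 := by simp
  simp [spiralProduct, WithLp.prod_inner_apply, real_inner_smul_left, real_inner_smul_right, h,
    mul_comm]

end Spiral

/-! ### The generating curve and its normal -/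

/-- The vector of `ℂ ⊕ ℝ` with coordinates `a`, `b`, `s` in the frame rotated by the angle `t`. -/
def rotated (t a b s : ℝ) : WithLp 2 (ℂ × ℝ) :=
  WithLp.toLp 2 (((a : ℂ) + b * Complex.I) * Complex.exp (t * Complex.I), s)

theorem contDiff_rotated {t a b s : ℝ → ℝ} (ht : ContDiff ℝ ∞ t) (ha : ContDiff ℝ ∞ a)
    (hb : ContDiff ℝ ∞ b) (hs : ContDiff ℝ ∞ s) :
    ContDiff ℝ ∞ fun x => rotated (t x) (a x) (b x) (s x) := by
  have h := Complex.ofRealCLM.contDiff (n := ∞)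
  exact (WithLp.prodContinuousLinearEquiv 2 ℝ ℂ ℝ).symm.contDiff.comp
    ((((h.comp ha).add ((h.comp hb).mul contDiff_const)).mul
      ((h.comp ht).mul contDiff_const).cexp).prodMk hs)

theorem hasDerivAt_rotated {t a b s : ℝ → ℝ} {t' a' b' s' x : ℝ} (ht : HasDerivAt t t' x)
    (ha : HasDerivAt a a' x) (hb : HasDerivAt b b' x) (hs : HasDerivAt s s' x) :
    HasDerivAt (fun x => rotated (t x) (a x) (b x) (s x))
      (rotated (t x) (a' - t' * b x) (b' + t' * a x) s') x := by
  have h := (ha.ofReal_comp.add (hb.ofReal_comp.mul_const Complex.I)).mul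
    (ht.ofReal_comp.mul_const Complex.I).cexp
  have h2 : HasDerivAt (fun x => ((a x : ℂ) + b x * Complex.I) * Complex.exp (t x * Complex.I))
      ((((a' - t' * b x : ℝ) : ℂ) + ((b' + t' * a x : ℝ) : ℂ) * Complex.I) *
        Complex.exp (t x * Complex.I)) x := by
    refine h.congr_deriv ?_
    push_cast
    simp only [Pi.add_apply]
    linear_combination (t' * b x * Complex.exp (t x * Complex.I)) * Complex.I_sq
  exact (WithLp.prodContinuousLinearEquiv 2 ℝ ℂ ℝ).symm.hasFDerivAt.comp_hasDerivAt x (h2.prodMk hs)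

theorem smul_rotated (c t a b s : ℝ) :
    c • rotated t a b s = rotated t (c * a) (c * b) (c * s) := by
  rw [rotated, rotated, ← WithLp.toLp_smul, Prod.smul_mk, Complex.real_smul, smul_eq_mul]
  push_cast
  congr 2
  ring

theorem inner_rotated (t a b s a' b' s' : ℝ) :
    ⟪rotated t a b s, rotated t a' b' s'⟫_ℝ = a * a' + b * b' + s * s' := by
  have h := Real.sin_sq_add_cos_sq t
  rw [rotated, rotated, WithLp.prod_inner_apply]
  simp [Complex.inner, Complex.exp_ofReal_mul_I_re, Complex.exp_ofReal_mul_I_im]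
  linear_combination (a * a' + b * b') * h

theorem rotated_add_two_pi (t a b s : ℝ) : rotated (t + 2 * Real.pi) a b s = rotated t a b s := by
  rw [rotated, rotated, Complex.ofReal_add, add_mul (t : ℂ), Complex.exp_add, Complex.ofReal_mul,
    Complex.ofReal_ofNat, Complex.exp_two_pi_mul_I, mul_one]

namespace ProfileCurve

variable {n : ℕ} {h C : ℝ}

/-- The generating curve. -/
def curve (p : ProfileCurve n h C) (φ : ℝ) : WithLp 2 (ℂ × ℝ) :=
  rotated (p.Θ φ) (Real.cos (p.X φ)) 0 (Real.sin (p.X φ))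

/-- The unit normal of the generating curve in the sphere. -/
def normal (p : ProfileCurve n h C) (φ : ℝ) : WithLp 2 (ℂ × ℝ) :=
  rotated (p.Θ φ) (R n h C (p.X φ) * Real.sin (p.X φ) / L n (p.X φ)) (p.D φ / L n (p.X φ))
    (-(R n h C (p.X φ) * Real.cos (p.X φ) / L n (p.X φ)))

/-- The velocity of the generating curve. -/
def velocity (p : ProfileCurve n h C) (φ : ℝ) : WithLp 2 (ℂ × ℝ) :=
  rotated (p.Θ φ) (-Real.sin (p.X φ) * (p.D φ * p.μ φ)) (R n h C (p.X φ) * p.μ φ)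
    (Real.cos (p.X φ) * (p.D φ * p.μ φ))

theorem contDiff_curve (p : ProfileCurve n h C) : ContDiff ℝ ∞ p.curve :=
  contDiff_rotated p.contDiff_Θ p.contDiff_X.cos contDiff_const p.contDiff_X.sin

theorem contDiff_normal (p : ProfileCurve n h C) : ContDiff ℝ ∞ p.normal := by
  have hR := (contDiff_R n h C).comp p.contDiff_X
  have hL := (contDiff_L n).comp p.contDiff_X
  have hL0 : ∀ φ, L n (p.X φ) ≠ 0 := fun φ => (L_pos n (p.mem φ)).ne'
  exact contDiff_rotated p.contDiff_Θ ((hR.mul p.contDiff_X.sin).div hL hL0)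
    (p.contDiff_D.div hL hL0) ((hR.mul p.contDiff_X.cos).div hL hL0).neg

theorem hasDerivAt_curve (p : ProfileCurve n h C) (φ : ℝ) :
    HasDerivAt p.curve (p.velocity φ) φ := by
  have hX := p.hasDerivAt_X φ
  have := (cos_pos_of_mem (p.mem φ)).ne'
  refine (hasDerivAt_rotated (p.hasDerivAt_Θ φ) hX.cos (hasDerivAt_const φ 0) hX.sin).congr_deriv ?_
  rw [velocity]
  congr 1
  · ring
  · field_simp
    ring

/-- The constant mean curvature equation for the curve: its principal curvature is `h` minus the `n
- 2` equal curvatures `slope` in the orbit directions. -/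
theorem hasDerivAt_normal (p : ProfileCurve n h C) (hn : 3 ≤ n) (φ : ℝ) :
    HasDerivAt p.normal (-(h - ((n : ℝ) - 2) * slope n h C (p.X φ)) • p.velocity φ) φ := by
  have hX := p.hasDerivAt_X φ
  have hR := (hasDerivAt_R hn h C (p.X φ)).comp φ hX
  have hL := (hasDerivAt_L hn (p.X φ)).comp φ hX
  have hL0 := (L_pos n (p.mem φ)).ne'
  refine (hasDerivAt_rotated (p.hasDerivAt_Θ φ) ((hR.mul hX.sin).div hL hL0)
    ((p.hasDerivAt_D φ).div hL hL0) ((hR.mul hX.cos).div hL hL0).neg).congr_deriv ?_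
  have hs := sin_pos_of_mem (p.mem φ)
  have hc := cos_pos_of_mem (p.mem φ)
  have hsc := Real.sin_sq_add_cos_sq (p.X φ)
  have hD := p.D_sq φ
  clear hL hL0 hR hX
  obtain ⟨j, rfl⟩ : ∃ j, n = j + 3 := ⟨n - 3, by omega⟩
  have hL : L (j + 3) (p.X φ) = Real.cos (p.X φ) * Real.sin (p.X φ) ^ j * Real.sin (p.X φ) := by
    rw [L, show j + 3 - 2 = j + 1 by omega]; ring
  simp only [Pi.mul_apply, Function.comp_apply, Pi.div_apply, slope, dL, dR, Nat.add_sub_cancel,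
    show j + 3 - 2 = j + 1 by omega, show j + 3 - 1 = j + 2 by omega, velocity, smul_rotated]
  rw [hL] at hD ⊢
  simp only [pow_add, pow_one]
  push_cast
  have hq : 0 < Real.sin (p.X φ) ^ j := pow_pos hs j
  set u := Real.sin (p.X φ)
  set c := Real.cos (p.X φ)
  set q := u ^ j
  set r := R (j + 3) h C (p.X φ)
  congr 1
  · field_simp
    linear_combination (p.D φ * p.μ φ * r) * hsc
  · field_simp
    rw [hD]
    ring
  · field_simp
    ring

theorem inner_normal_curve (p : ProfileCurve n h C) (φ : ℝ) : ⟪p.normal φ, p.curve φ⟫_ℝ = 0 := by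
  rw [normal, curve, inner_rotated]
  ring

theorem inner_normal_velocity (p : ProfileCurve n h C) (φ : ℝ) :
    ⟪p.normal φ, p.velocity φ⟫_ℝ = 0 := by
  rw [normal, velocity, inner_rotated]
  linear_combination (-(R n h C (p.X φ) * p.D φ * p.μ φ / L n (p.X φ))) *
    Real.sin_sq_add_cos_sq (p.X φ)

theorem inner_curve_curve (p : ProfileCurve n h C) (φ : ℝ) : ⟪p.curve φ, p.curve φ⟫_ℝ = 1 := by
  rw [curve, inner_rotated]
  linear_combination Real.sin_sq_add_cos_sq (p.X φ)

theorem inner_normal_normal (p : ProfileCurve n h C) (φ : ℝ) :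
    ⟪p.normal φ, p.normal φ⟫_ℝ = 1 := by
  rw [normal, inner_rotated]
  have h1 := (L_pos n (p.mem φ)).ne'
  field_simp
  linear_combination R n h C (p.X φ) ^ 2 * Real.sin_sq_add_cos_sq (p.X φ) + p.D_sq φ

theorem velocity_ne_zero (p : ProfileCurve n h C) (hn : 3 ≤ n) (hh : 0 < h) (hC : 0 < C)
    (φ : ℝ) : p.velocity φ ≠ 0 := by
  intro h0
  have h1 : ⟪p.velocity φ, p.velocity φ⟫_ℝ = 0 := by rw [h0, inner_zero_left]
  rw [velocity, inner_rotated] at h1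
  have h2 := mul_pos (R_pos hn hh hC (p.mem φ)) (p.μ_pos φ)
  nlinarith [mul_self_nonneg (Real.sin (p.X φ) * (p.D φ * p.μ φ)),
    mul_self_nonneg (Real.cos (p.X φ) * (p.D φ * p.μ φ))]

theorem Θ_strictMono (p : ProfileCurve n h C) (hn : 3 ≤ n) (hh : 0 < h) (hC : 0 < C) :
    StrictMono p.Θ := by
  refine strictMono_of_deriv_pos fun φ => ?_
  rw [(p.hasDerivAt_Θ φ).deriv]
  exact div_pos (mul_pos (R_pos hn hh hC (p.mem φ)) (p.μ_pos φ)) (cos_pos_of_mem (p.mem φ))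

theorem Θ_add_int_mul (p : ProfileCurve n h C) (φ : ℝ) (k : ℤ) :
    p.Θ (φ + k * (2 * Real.pi)) = p.Θ φ + k * W n h C := by
  -- Subtracting the linear function of the same mean growth leaves a periodic function.
  have hper : Function.Periodic (fun φ => p.Θ φ - φ / (2 * Real.pi) * W n h C) (2 * Real.pi) := by
    intro φ
    have := Real.pi_pos
    simp only [p.Θ_add_two_pi]
    field_simp
    ring
  have h1 := hper.int_mul k φ
  have := Real.pi_pos
  have h2 : (φ + k * (2 * Real.pi)) / (2 * Real.pi) = φ / (2 * Real.pi) + k := by field_simp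
  rw [h2] at h1
  linarith

theorem closure_J (p : ProfileCurve n h C) :
    closure (J n h C) = p.X '' Icc (-(Real.pi / 2)) (Real.pi / 2) := by
  have hX := p.contDiff_X.continuous
  rw [p.J_eq]
  refine subset_antisymm (closure_minimal (image_mono Ioo_subset_Icc_self)
    (isCompact_Icc.image hX).isClosed) ?_
  rw [← closure_Ioo (by linarith [Real.pi_pos] : -(Real.pi / 2) ≠ Real.pi / 2)]
  exact image_closure_subset_closure_image hX

theorem curve_eq (p : ProfileCurve n h C) (φ : ℝ) :
    p.curve φ = WithLp.toLp 2
      ((Real.cos (p.X φ) : ℂ) * Complex.exp ((p.Θ φ : ℂ) * Complex.I), Real.sin (p.X φ)) := by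
  simp [curve, rotated]

theorem range_curve (p : ProfileCurve n h C) : range p.curve = generatingCurve n h C := by
  have hpi := Real.pi_pos
  have hXk : ∀ φ (k : ℤ), p.X (φ + k * (2 * Real.pi)) = p.X φ := fun φ k => p.X_periodic.int_mul k φ
  ext P
  constructor
  · rintro ⟨φ, rfl⟩
    -- The parameter is moved into `[-π/2, 3π/2)`. The first half is the local curve; the second is
    -- its reflection, which explains the index `1 - k` in place of `-k`.
    obtain ⟨k, hk, -⟩ := existsUnique_add_zsmul_mem_Ico Real.two_pi_pos φ (-(Real.pi / 2))
    rw [zsmul_eq_mul] at hk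
    have hX := hXk φ k
    have hΘ := p.Θ_add_int_mul φ k
    set ψ := φ + k * (2 * Real.pi)
    rw [generatingCurve, mem_ofPred_eq, p.closure_J]
    rcases le_total ψ (Real.pi / 2) with hle | hle
    · refine ⟨_, mem_image_of_mem p.X ⟨hk.1, hle⟩, -k, p.Θ φ, Or.inl ?_, ?_⟩
      · rw [p.phase_eq ψ ⟨hk.1, hle⟩, hΘ]
        push_cast
        ring
      · rw [hX, curve_eq]
    · have hmem : Real.pi - ψ ∈ Icc (-(Real.pi / 2)) (Real.pi / 2) :=
        ⟨by linarith [hk.2], by linarith⟩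
      refine ⟨_, mem_image_of_mem p.X hmem, 1 - k, p.Θ φ, Or.inr ?_, ?_⟩
      · rw [p.phase_eq _ hmem, p.Θ_symm, hΘ]
        push_cast
        ring
      · rw [p.X_symm, hX, curve_eq]
  · rintro ⟨s, hs, m, θ, hθ, rfl⟩
    rw [p.closure_J] at hs
    obtain ⟨φ, hφ, rfl⟩ := hs
    rw [p.phase_eq φ hφ] at hθ
    rcases hθ with rfl | rfl
    · refine ⟨φ + m * (2 * Real.pi), ?_⟩
      rw [curve_eq, hXk, p.Θ_add_int_mul]
    · refine ⟨Real.pi - φ + (m - 1 : ℤ) * (2 * Real.pi), ?_⟩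
      rw [curve_eq, hXk, p.Θ_add_int_mul, p.X_symm, p.Θ_symm]
      congr 5
      push_cast
      ring

theorem curve_periodic (p : ProfileCurve n h C) (hW : W n h C = Real.pi) :
    Function.Periodic p.curve (4 * Real.pi) := by
  intro φ
  have h1 := p.Θ_add_int_mul φ 2
  have h2 := p.X_periodic.int_mul 2 φ
  rw [hW] at h1
  push_cast at h1 h2
  rw [show φ + 4 * Real.pi = φ + 2 * (2 * Real.pi) by ring, curve, h1, h2, rotated_add_two_pi,
    curve]

theorem normal_periodic (p : ProfileCurve n h C) (hW : W n h C = Real.pi) :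
    Function.Periodic p.normal (4 * Real.pi) := by
  intro φ
  have h1 := p.Θ_add_int_mul φ 2
  have h2 := p.X_periodic.int_mul 2 φ
  have h3 := p.D_periodic.int_mul 2 φ
  rw [hW] at h1
  push_cast at h1 h2 h3
  rw [show φ + 4 * Real.pi = φ + 2 * (2 * Real.pi) by ring, normal, h1, h2, h3,
    rotated_add_two_pi, normal]

/-- The modulus determines `cos (X φ)`, hence the phases agree modulo `2π`; strict monotonicity of
the phase, which gains `2π` per `4π`, does the rest. Only the `ℂ`-component is used, so the same
argument serves the hypersurface. -/
theorem exists_int_of_curve_fst_eq (p : ProfileCurve n h C) (hn : 3 ≤ n) (hh : 0 < h) (hC : 0 < C)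
    (hW : W n h C = Real.pi) {φ ψ : ℝ} (heq : (p.curve φ).fst = (p.curve ψ).fst) :
    ∃ k : ℤ, φ = ψ + k * (4 * Real.pi) := by
  have hc1 := cos_pos_of_mem (p.mem φ)
  have hc2 := cos_pos_of_mem (p.mem ψ)
  rw [curve_eq, curve_eq] at heq
  change (Real.cos (p.X φ) : ℂ) * Complex.exp ((p.Θ φ : ℂ) * Complex.I) =
    (Real.cos (p.X ψ) : ℂ) * Complex.exp ((p.Θ ψ : ℂ) * Complex.I) at heq
  have hnorm := congrArg norm heq
  rw [norm_mul, norm_mul, Complex.norm_exp_ofReal_mul_I, Complex.norm_exp_ofReal_mul_I,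
    Complex.norm_real, Complex.norm_real, Real.norm_of_nonneg hc1.le, Real.norm_of_nonneg hc2.le,
    mul_one, mul_one] at hnorm
  rw [hnorm] at heq
  have hexp := mul_left_cancel₀ (Complex.ofReal_ne_zero.2 hc2.ne') heq
  have hexp' : Circle.exp (p.Θ φ) = Circle.exp (p.Θ ψ) := by
    ext
    simpa only [Circle.coe_exp] using hexp
  obtain ⟨k, hk⟩ := Circle.exp_eq_exp.1 hexp'
  refine ⟨k, (p.Θ_strictMono hn hh hC).injective ?_⟩
  have h1 := p.Θ_add_int_mul ψ (2 * k)
  rw [hW] at h1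
  push_cast at h1
  rw [show ψ + k * (4 * Real.pi) = ψ + 2 * k * (2 * Real.pi) by ring, h1, hk]
  ring

end ProfileCurve

/-! ### Closing up -/

/-- The map on the circle induced by a `4π`-periodic map on the line. -/
def onCircle {F : Type*} (f : ℝ → F) (z : Circle) : F := f (2 * Complex.arg z)

theorem onCircle_exp {F : Type*} {f : ℝ → F} (hf : Function.Periodic f (4 * Real.pi)) (t : ℝ) :
    onCircle f (Circle.exp t) = f (2 * t) := by
  obtain ⟨m, hm⟩ := Circle.exp_eq_exp.1 (Circle.exp_arg (Circle.exp t))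
  rw [onCircle, hm, show 2 * (t + m * (2 * Real.pi)) = 2 * t + m * (4 * Real.pi) by ring]
  exact hf.int_mul m _

theorem range_onCircle {F : Type*} {f : ℝ → F} (hf : Function.Periodic f (4 * Real.pi)) :
    range (onCircle f) = range f := by
  refine subset_antisymm (range_subset_iff.2 fun z => mem_range_self _)
    (range_subset_iff.2 fun t => ⟨Circle.exp (t / 2), ?_⟩)
  rw [onCircle_exp hf, mul_div_cancel₀ _ two_ne_zero]

section

variable {F : Type*} [NormedAddCommGroup F] [NormedSpace ℝ F] {f : ℝ → F}

theorem contMDiff_onCircle (hf : Function.Periodic f (4 * Real.pi)) (hs : ContDiff ℝ ∞ f) :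
    ContMDiff (𝓡 1) 𝓘(ℝ, F) ∞ (onCircle f) := by
  refine contMDiff_of_comp_circleExp ?_
  simp only [onCircle_exp hf]
  exact hs.comp (contDiff_const.mul contDiff_id)

theorem mvfderiv_onCircle (hf : Function.Periodic f (4 * Real.pi)) (hs : ContDiff ℝ ∞ f) {f' : F}
    {t : ℝ} (hd : HasDerivAt f f' (2 * t)) :
    mvfderiv (𝓡 1) (onCircle f) (Circle.exp t) (circleVelocity t) = (2 : ℝ) • f' := by
  refine mvfderiv_circleVelocity ((contMDiff_onCircle hf hs).mdifferentiable (by simp) _) ?_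
  simp only [onCircle_exp hf]
  exact hd.scomp t (by simpa using (hasDerivAt_id t).const_mul 2)

end

namespace ProfileCurve

variable {n : ℕ} {h C : ℝ}

theorem isEmbedded_onCircle_curve (p : ProfileCurve n h C) (hn : 3 ≤ n) (hh : 0 < h) (hC : 0 < C)
    (hW : W n h C = Real.pi) : IsEmbedded (𝓡 1) (onCircle p.curve) := by
  have hsm := contMDiff_onCircle (p.curve_periodic hW) p.contDiff_curve
  refine ⟨hsm, fun z => ?_, ?_⟩
  · obtain ⟨t, rfl⟩ := Circle.exp_surjective z
    refine (injective_iff_map_eq_zero _).2 fun v hv => ?_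
    obtain ⟨c, rfl⟩ := exists_eq_smul_circleVelocity t v
    rw [map_smul, mvfderiv_onCircle (p.curve_periodic hW) p.contDiff_curve
      (p.hasDerivAt_curve _)] at hv
    have := p.velocity_ne_zero hn hh hC (2 * t)
    have hc : c = 0 := by simpa [this] using hv
    rw [hc, zero_smul]
  · refine (hsm.continuous.isClosedEmbedding fun z w hzw => ?_).isEmbedding
    obtain ⟨t, rfl⟩ := Circle.exp_surjective z
    obtain ⟨u, rfl⟩ := Circle.exp_surjective w
    rw [onCircle_exp (p.curve_periodic hW), onCircle_exp (p.curve_periodic hW)] at hzw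
    obtain ⟨k, hk⟩ := p.exists_int_of_curve_fst_eq hn hh hC hW (congrArg WithLp.fst hzw)
    exact Circle.exp_eq_exp.2 ⟨k, by linarith⟩

theorem onCircle_curve_snd_pos (p : ProfileCurve n h C) (z : Circle) :
    0 < (onCircle p.curve z).snd :=
  sin_pos_of_mem (p.mem _)

theorem eq_zero_of_smul_add_smul_eq_zero {E : Type*} [NormedAddCommGroup E]
    [InnerProductSpace ℝ E] {x w : E} {a b : ℝ} (hx : ‖x‖ = 1) (hw : ⟪x, w⟫_ℝ = 0)
    (hab : a • x + b • w = 0) : a = 0 := by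
  have := congrArg (fun y => ⟪x, y⟫_ℝ) hab
  simpa [inner_add_right, real_inner_smul_right, hw, hx] using this

theorem isEmbedded_spiralProduct (p : ProfileCurve n h C) (hn : 3 ≤ n) (hh : 0 < h) (hC : 0 < C)
    (hW : W n h C = Real.pi) :
    IsEmbedded ((𝓡 1).prod (𝓡 (n - 2))) (spiralProduct n (onCircle p.curve)) := by
  have hemb := p.isEmbedded_onCircle_curve hn hh hC hW
  have hsm := contMDiff_spiralProduct (n := n) hemb.smooth
  refine ⟨hsm, fun q => ?_, ?_⟩
  · refine (injective_iff_map_eq_zero _).2 fun v hv => ?_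
    rw [mvfderiv_spiralProduct hemb.smooth] at hv
    have hb := p.onCircle_curve_snd_pos q.1
    have hv1 : (mvfderiv (𝓡 1) (onCircle p.curve) q.1 v.1).fst = 0 := congrArg WithLp.fst hv
    have hv2 : (mvfderiv (𝓡 1) (onCircle p.curve) q.1 v.1).snd •
        (q.2 : EuclideanSpace ℝ (Fin (n - 2 + 1))) + (onCircle p.curve q.1).snd •
          mvfderiv (𝓡 (n - 2)) ((↑) : Orbit n → EuclideanSpace ℝ (Fin (n - 2 + 1))) q.2 v.2 = 0 :=
      congrArg WithLp.snd hv
    have hv3 : (mvfderiv (𝓡 1) (onCircle p.curve) q.1 v.1).snd = 0 :=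
      eq_zero_of_smul_add_smul_eq_zero (by simp) (inner_mvfderiv_orbit_coe q.2 v.2) hv2
    rw [hv3, zero_smul, zero_add, smul_eq_zero] at hv2
    have hv4 := (injective_iff_map_eq_zero _).1 (injective_mvfderiv_orbit_coe q.2) v.2
      (hv2.resolve_left hb.ne')
    have hv5 := (injective_iff_map_eq_zero _).1 (hemb.immersion q.1) v.1
      (WithLp.ofLp_injective 2 (Prod.ext hv1 hv3))
    exact Prod.ext hv5 hv4
  · refine (hsm.continuous.isClosedEmbedding ?_).isEmbedding
    rintro ⟨z, x⟩ ⟨w, y⟩ heq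
    have heq1 := congrArg (fun P : Ambient n => P.fst) heq
    have heq2 := congrArg (fun P : Ambient n => P.snd) heq
    have h1 : (onCircle p.curve z).fst = (onCircle p.curve w).fst := heq1
    have h2 : (onCircle p.curve z).snd • (x : EuclideanSpace ℝ (Fin (n - 2 + 1))) =
        (onCircle p.curve w).snd • (y : EuclideanSpace ℝ (Fin (n - 2 + 1))) := heq2
    have hzw : z = w := by
      obtain ⟨t, rfl⟩ := Circle.exp_surjective z
      obtain ⟨u, rfl⟩ := Circle.exp_surjective w
      rw [onCircle_exp (p.curve_periodic hW), onCircle_exp (p.curve_periodic hW)] at h1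
      obtain ⟨k, hk⟩ := p.exists_int_of_curve_fst_eq hn hh hC hW h1
      exact Circle.exp_eq_exp.2 ⟨k, by linarith⟩
    subst hzw
    exact Prod.ext rfl (Subtype.ext (smul_right_injective _ (p.onCircle_curve_snd_pos z).ne' h2))

theorem range_spiralProduct (p : ProfileCurve n h C) (hW : W n h C = Real.pi) :
    range (spiralProduct n (onCircle p.curve)) = delaunayHypersurface n h C := by
  have hr := (range_onCircle (p.curve_periodic hW)).trans p.range_curve
  ext P
  constructor
  · rintro ⟨⟨z, x⟩, rfl⟩
    exact ⟨_, hr ▸ mem_range_self z, x, rfl⟩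
  · rintro ⟨P, hP, x, rfl⟩
    rw [← hr] at hP
    obtain ⟨z, rfl⟩ := hP
    exact ⟨(z, x), rfl⟩

theorem norm_eq_one_of_inner {E : Type*} [NormedAddCommGroup E] [InnerProductSpace ℝ E] {x : E}
    (hx : ⟪x, x⟫_ℝ = 1) : ‖x‖ = 1 := by
  rw [real_inner_self_eq_norm_sq] at hx
  exact (pow_eq_one_iff_of_nonneg (norm_nonneg x) two_ne_zero).1 hx

/-- The normal field is again a spiral product, generated by the normal of the curve. -/
theorem isUnitNormal_spiralProduct (p : ProfileCurve n h C) (hn : 3 ≤ n)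
    (hW : W n h C = Real.pi) :
    IsUnitNormal ((𝓡 1).prod (𝓡 (n - 2))) (spiralProduct n (onCircle p.curve))
      (spiralProduct n (onCircle p.normal)) := by
  have hσ := contMDiff_onCircle (p.curve_periodic hW) p.contDiff_curve
  have hν := contMDiff_onCircle (p.normal_periodic hW) p.contDiff_normal
  refine ⟨fun q => norm_eq_one_of_inner ?_, ?_, contMDiff_spiralProduct hν,
    fun q => norm_eq_one_of_inner ?_, fun q => ?_, fun q v => ?_⟩
  · rw [inner_spiralProduct, onCircle, inner_curve_curve]
  · rw [(WithLp.linearEquiv 2 ℝ (ℂ × EuclideanSpace ℝ (Fin (n - 2 + 1)))).finrank_eq]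
    simp
    omega
  · rw [inner_spiralProduct, onCircle, inner_normal_normal]
  · rw [inner_spiralProduct, onCircle, onCircle, inner_normal_curve]
  · rw [mvfderiv_spiralProduct hσ]
    obtain ⟨⟨z, x⟩, rfl⟩ : ∃ q', q = q' := ⟨q, rfl⟩
    obtain ⟨t, rfl⟩ := Circle.exp_surjective z
    obtain ⟨c, hc⟩ := exists_eq_smul_circleVelocity t v.1
    have hx : ‖(x : EuclideanSpace ℝ (Fin (n - 2 + 1)))‖ = 1 := by simp
    have h0 := inner_mvfderiv_orbit_coe x v.2
    have h1 : ⟪(p.normal (2 * t)).fst, (p.velocity (2 * t)).fst⟫_ℝ +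
        (p.normal (2 * t)).snd * (p.velocity (2 * t)).snd = 0 := by
      have := p.inner_normal_velocity (2 * t)
      rw [WithLp.prod_inner_apply] at this
      simpa [mul_comm] using this
    rw [hc, map_smul, mvfderiv_onCircle (p.curve_periodic hW) p.contDiff_curve
      (p.hasDerivAt_curve _), spiralProduct, WithLp.prod_inner_apply]
    simp only [onCircle_exp (p.curve_periodic hW), onCircle_exp (p.normal_periodic hW)]
    simp only [WithLp.smul_fst, WithLp.smul_snd, smul_eq_mul, inner_add_right,
      real_inner_smul_left, real_inner_smul_right, h0, real_inner_self_eq_norm_sq, hx]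
    linear_combination (c * 2) * h1

theorem inner_snd_normal_neg (p : ProfileCurve n h C) (hn : 3 ≤ n) (hh : 0 < h) (hC : 0 < C)
    (q : Circle × Orbit n) :
    ⟪(spiralProduct n (onCircle p.normal) q).snd,
      (q.2 : EuclideanSpace ℝ (Fin (n - 2 + 1)))⟫_ℝ < 0 := by
  have hx : ‖(q.2 : EuclideanSpace ℝ (Fin (n - 2 + 1)))‖ = 1 := by simp
  change ⟪(onCircle p.normal q.1).snd • (q.2 : EuclideanSpace ℝ (Fin (n - 2 + 1))), _⟫_ℝ < 0
  rw [real_inner_smul_left, real_inner_self_eq_norm_sq, hx]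
  have hm := p.mem (2 * Complex.arg q.1)
  have := div_pos (mul_pos (R_pos hn hh hC hm) (cos_pos_of_mem hm)) (L_pos n hm)
  change -_ * _ < (0 : ℝ)
  linarith

/-- In the orbit directions both differentials multiply by the `ℝ`-component of the generating
curve, so this ratio makes `slope` the principal curvature there. -/
theorem normal_snd (p : ProfileCurve n h C) (hn : 3 ≤ n) (φ : ℝ) :
    (p.normal φ).snd = -(slope n h C (p.X φ) * (p.curve φ).snd) := by
  change -(R n h C (p.X φ) * Real.cos (p.X φ) / L n (p.X φ)) =
    -(slope n h C (p.X φ) * Real.sin (p.X φ))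
  have hs := (sin_pos_of_mem (p.mem φ)).ne'
  have hc := (cos_pos_of_mem (p.mem φ)).ne'
  rw [slope, L, show n - 1 = n - 2 + 1 by omega, pow_succ]
  field_simp

theorem hasCMC_spiralProduct (p : ProfileCurve n h C) (hn : 3 ≤ n) (hW : W n h C = Real.pi) :
    HasCMC ((𝓡 1).prod (𝓡 (n - 2))) (spiralProduct n (onCircle p.curve))
      (spiralProduct n (onCircle p.normal)) h := by
  have hσ := contMDiff_onCircle (p.curve_periodic hW) p.contDiff_curve
  have hν := contMDiff_onCircle (p.normal_periodic hW) p.contDiff_normal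
  rintro ⟨z, x⟩
  obtain ⟨t, rfl⟩ := Circle.exp_surjective z
  set k := slope n h C (p.X (2 * t)) with hk
  -- The shape operator is diagonal: `h - (n - 2) k` on the line tangent to the curve and `k` on the
  -- `n - 2` orbit directions, with trace `h`.
  refine ⟨LinearMap.prodMap ((h - ((n : ℝ) - 2) * k) • LinearMap.id (M := EuclideanSpace ℝ (Fin 1)))
    (k • LinearMap.id (M := EuclideanSpace ℝ (Fin (n - 2)))), fun v => ?_, ?_⟩
  · have hsnd : (onCircle p.normal (Circle.exp t)).snd =
        -(k * (onCircle p.curve (Circle.exp t)).snd) := by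
      rw [onCircle_exp (p.curve_periodic hW), onCircle_exp (p.normal_periodic hW)]
      exact p.normal_snd hn _
    have hd : ∀ w, mvfderiv (𝓡 1) (onCircle p.normal) (Circle.exp t) w =
        -(h - ((n : ℝ) - 2) * k) • mvfderiv (𝓡 1) (onCircle p.curve) (Circle.exp t) w := by
      intro w
      obtain ⟨c, rfl⟩ := exists_eq_smul_circleVelocity t w
      rw [map_smul, map_smul,
        mvfderiv_onCircle (p.curve_periodic hW) p.contDiff_curve (p.hasDerivAt_curve _),
        mvfderiv_onCircle (p.normal_periodic hW) p.contDiff_normal (p.hasDerivAt_normal hn _)]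
      module
    have key : ∀ (w : TangentSpace (𝓡 1) (Circle.exp t)) (u : TangentSpace (𝓡 (n - 2)) x),
        (WithLp.toLp 2 ((mvfderiv (𝓡 1) (onCircle p.normal) (Circle.exp t) w).fst,
          (mvfderiv (𝓡 1) (onCircle p.normal) (Circle.exp t) w).snd •
            (x : EuclideanSpace ℝ (Fin (n - 2 + 1))) + (onCircle p.normal (Circle.exp t)).snd •
              mvfderiv (𝓡 (n - 2)) ((↑) : Orbit n → EuclideanSpace ℝ (Fin (n - 2 + 1))) x u) :
                Ambient n) =
        -WithLp.toLp 2 ((mvfderiv (𝓡 1) (onCircle p.curve) (Circle.exp t)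
            ((h - ((n : ℝ) - 2) * k) • w)).fst,
          (mvfderiv (𝓡 1) (onCircle p.curve) (Circle.exp t) ((h - ((n : ℝ) - 2) * k) • w)).snd •
            (x : EuclideanSpace ℝ (Fin (n - 2 + 1))) + (onCircle p.curve (Circle.exp t)).snd •
              mvfderiv (𝓡 (n - 2)) ((↑) : Orbit n → EuclideanSpace ℝ (Fin (n - 2 + 1))) x
                (k • u)) := by
      intro w u
      rw [hd, map_smul, map_smul, hsnd, ← WithLp.toLp_neg, Prod.neg_mk]
      simp only [WithLp.smul_fst, WithLp.smul_snd]
      congr 2 <;> module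
    rw [mvfderiv_spiralProduct hσ, mvfderiv_spiralProduct hν]
    exact key v.1 v.2
  · refine (LinearMap.trace_prodMap' _ _).trans ?_
    rw [map_smul, map_smul, LinearMap.trace_id, LinearMap.trace_id]
    simp [Nat.cast_sub (show 2 ≤ n by omega)]
    ring

theorem isEmbeddedDelaunay (p : ProfileCurve n h C) (hn : 3 ≤ n) (hh : 0 < h) (hC : 0 < C)
    (hW : W n h C = Real.pi) : IsEmbeddedDelaunay n h C :=
  ⟨onCircle p.curve, spiralProduct n (onCircle p.normal),
    p.isEmbedded_onCircle_curve hn hh hC hW,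
    (range_onCircle (p.curve_periodic hW)).trans p.range_curve,
    p.isEmbedded_spiralProduct hn hh hC hW, p.range_spiralProduct hW,
    p.isUnitNormal_spiralProduct hn hW, p.inner_snd_normal_neg hn hh hC,
    p.hasCMC_spiralProduct hn hW⟩

end ProfileCurve

end

end Delaunay

/-! ### Existence for every small `h`, and uncountability -/

theorem mainTheorem5 (n : ℕ) (hn : 3 ≤ n) :
    (∀ h ∈ Set.Ioo (0 : ℝ) (Real.sqrt (4 * ((n : ℝ) - 2) / 3)),
      ∃ C ∈ Set.Ioo (0 : ℝ) (Delaunay.Cmax n h),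
        MeasureTheory.IntegrableOn (Delaunay.phaseSpeed n h C) (Delaunay.J n h C) ∧
        Delaunay.W n h C = Real.pi ∧
        Delaunay.IsEmbeddedDelaunay n h C) ∧
    ¬ {h : ℝ | 0 < h ∧ ∃ C ∈ Set.Ioo (0 : ℝ) (Delaunay.Cmax n h),
        Delaunay.IsEmbeddedDelaunay n h C}.Countable := by
  have hn' : (3 : ℝ) ≤ n := by exact_mod_cast hn
  have key : ∀ h ∈ Set.Ioo (0 : ℝ) (Real.sqrt (4 * ((n : ℝ) - 2) / 3)),
      ∃ C ∈ Set.Ioo (0 : ℝ) (Delaunay.Cmax n h),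
        MeasureTheory.IntegrableOn (Delaunay.phaseSpeed n h C) (Delaunay.J n h C) ∧
        Delaunay.W n h C = Real.pi ∧
        Delaunay.IsEmbeddedDelaunay n h C := by
    intro h hh
    obtain ⟨ς, H⟩ := Delaunay.exists_isGapCoordinate hn hh.1
    obtain ⟨C, hC, hW⟩ := Delaunay.exists_W_eq_pi hn hh.1 ((Real.lt_sqrt hh.1.le).1 hh.2)
    exact ⟨C, hC, H.integrableOn_phaseSpeed hC, hW,
      (H.profileCurve hC).isEmbeddedDelaunay hn hh.1 hC.1 hW⟩
  refine ⟨key, fun hcount => ?_⟩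
  have hpos : 0 < Real.sqrt (4 * ((n : ℝ) - 2) / 3) :=
    Real.sqrt_pos.2 (div_pos (by linarith) three_pos)
  -- The set contains a nonempty open interval, which has the cardinality of the continuum.
  refine (Cardinal.mk_Ioo_real hpos ▸ Cardinal.aleph0_lt_continuum).not_ge
    (Cardinal.le_aleph0_iff_set_countable.2 (hcount.mono fun h hh => ?_))
  obtain ⟨C, hC, -, -, hE⟩ := key h hh
  exact ⟨hh.1, C, hC, hE⟩
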